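/- **Notation.** $\|\cdot\|_2$ is the spectral norm, $\mathrm{eig}(B)$ the spectrum of a square matrix $B$, $\mathrm{span}(B)$ the column space of $B$, and for $\epsilon\ge 0$ $$\mathrm{eig}_\epsilon(B):=\bigcup_{\|F\|_2\le\epsilon}\mathrm{eig}(B+F),\qquad \mathrm{sep}(B,C):=\min\{\|BX-XC\|_2:\|X\|_2=1\}.$$ A pair $(X,M)$ is a right invariant pair of $B$ if $X$ has full column rank and $BX=XM$; $(Y,N)$ is a left invariant pair of $B$ if $Y$ has full column rank and $Y^*B=NY^*$. For nonzero subspaces $\mathcal U,\mathcal V\subset\mathbb C^n$ of equal dimension, $\theta_{\max}(\mathcal U,\mathcal V)\in[0,\pi/2]$ is given by $\sin\theta_{\max}(\mathcal U,\mathcal V)=\max\{\|(I-P_{\mathcal V})u\|_2:u\in\mathcal U,\ \|u\|_2=1\}$, with $P_{\mathcal V}$ the orthogonal projection onto $\mathcal V$. **Theorem.** Let $1\le m<n$, let $A=\begin{bmatrix}A_{11}&A_{12}\\0&A_{22}\end{bmatrix}\in\mathbb C^{n\times n}$ with $A_{11}\in\mathbb C^{m\times m}$, and suppose that $s:=\mathrm{sep}(A_{22},A_{11})>0$.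 Then there is a unique $R\in\mathbb C^{m\times(n-m)}$ with $A_{11}R-RA_{22}=-A_{12}$. Put $$P:=\begin{bmatrix}I_m&-R\\0&0\end{bmatrix},\quad p:=\|P\|_2,\quad S:=\begin{bmatrix}I_m&R/p\\0&I_{n-m}/p\end{bmatrix},\quad \phi(\epsilon):=(p+\sqrt{p^2-1})\,\epsilon .$$ Then $P$ is the spectral projection of $A$ corresponding to $\mathrm{eig}(A_{11})$ and $p=\sqrt{1+\|R\|_2^2}$. Moreover $S$ is invertible, $S^{-1}=\begin{bmatrix}I_m&-R\\0&pI_{n-m}\end{bmatrix}$, $S^{-1}AS=\mathrm{diag}(A_{11},A_{22})$, and $$\|S^{-1}\|_2\|S\|_2=p+\sqrt{p^2-1}=\min\{\|U^{-1}\|_2\|U\|_2: U \text{ nonsingular},\ U^{-1}AU=\mathrm{diag}(A_{11},A_{22})\}.$$ Let $E=\begin{bmatrix}E_{11}&E_{12}\\E_{21}&E_{22}\end{bmatrix}\in\mathbb C^{n\times n}$, partitioned like $A$, satisfy $\|E\|_2<\dfrac{s}{2(p+\sqrt{p^2-1})}$. Put $\widehat E_{11}:=E_{11}-RE_{21}$,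 $\widehat E_{12}:=\frac1p\big[E_{11}R+E_{12}-R(E_{21}R+E_{22})\big]$, $\widehat E_{22}:=E_{21}R+E_{22}$, and, for $X\in\mathbb C^{(n-m)\times m}$, $M:=A_{11}+\widehat E_{11}+\widehat E_{12}X$ and $N:=A_{22}+\widehat E_{22}-X\widehat E_{12}$. Then there is a unique $X\in\mathbb C^{(n-m)\times m}$ that satisfies both $$\begin{bmatrix}I_m&0\\X&I_{n-m}\end{bmatrix}^{-1}S^{-1}(A+E)S\begin{bmatrix}I_m&0\\X&I_{n-m}\end{bmatrix}=\begin{bmatrix}M&\widehat E_{12}\\0&N\end{bmatrix}\quad\text{and}\quad \|X\|_2\le\frac{2(p+\sqrt{p^2-1})\|E\|_2}{s}.$$ For this $X$ the following hold. (a) $\mathrm{eig}_{\phi(\|E\|_2)}(A_{11})\cap\mathrm{eig}_{\phi(\|E\|_2)}(A_{22})=\emptyset$. (b) $\mathrm{eig}(M)\subset\mathrm{eig}_{\phi(\|E\|_2)}(A_{11})$ and $\mathrm{eig}(N)\subset\mathrm{eig}_{\phi(\|E\|_2)}(A_{22})$. (c) $\left(S\begin{bmatrix}I_m\\X\end{bmatrix},M\right)$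 and $\left((S^{-1})^*\begin{bmatrix}-X^*\\I_{n-m}\end{bmatrix},N\right)$ are right and left invariant pairs of $A+E$, respectively. (d) Let $\mathcal X:=\mathrm{span}\begin{bmatrix}I_m\\0\end{bmatrix}$ and $\mathcal X_E:=\mathrm{span}\left(S\begin{bmatrix}I_m\\X\end{bmatrix}\right)$. Then $A\mathcal X\subset\mathcal X$, $(A+E)\mathcal X_E\subset\mathcal X_E$, $\theta_{\max}(\mathcal X,\mathcal X_E)<\pi/2$ and $$\tan\theta_{\max}(\mathcal X,\mathcal X_E)\le\frac{2(p+\sqrt{p^2-1})^2\|E\|_2}{s}.$$ (e) Let $\mathcal Y:=\mathrm{span}\begin{bmatrix}0\\I_{n-m}\end{bmatrix}$ and $\mathcal Y_E:=\mathrm{span}\left((S^{-1})^*\begin{bmatrix}-X^*\\I_{n-m}\end{bmatrix}\right)$. Then $A^*\mathcal Y\subset\mathcal Y$, $(A+E)^*\mathcal Y_E\subset\mathcal Y_E$, $\theta_{\max}(\mathcal Y,\mathcal Y_E)<\pi/2$ and $$\tan\theta_{\max}(\mathcal Y,\mathcal Y_E)\le\frac{2(p+\sqrt{p^2-1})^2\|E\|_2}{s}.$$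 -/

import Mathlib

open scoped Matrix Matrix.Norms.L2Operator

noncomputable section

/-- The separation `sep(A, B) = min {‖AX - XB‖₂ : ‖X‖₂ = 1}` of two square matrices. Here and
below `‖·‖` is the spectral norm of a matrix. (If one of the sizes is `0`, the set is empty and
the infimum is `0`.) -/
def sep {m k : ℕ} (A : Matrix (Fin m) (Fin m) ℂ) (B : Matrix (Fin k) (Fin k) ℂ) : ℝ :=
  sInf {r : ℝ | ∃ X : Matrix (Fin m) (Fin k) ℂ, ‖X‖ = 1 ∧ r = ‖A * X - X * B‖}

/-- The `ε`-pseudospectrum of `A`: all eigenvalues of all `A + F` with `‖F‖₂ ≤ ε`. -/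
def pseudospectrum {m : ℕ} (ε : ℝ) (A : Matrix (Fin m) (Fin m) ℂ) : Set ℂ :=
  {z | ∃ F : Matrix (Fin m) (Fin m) ℂ, ‖F‖ ≤ ε ∧ z ∈ spectrum ℂ (A + F)}

/-- The column space of a matrix, as a subspace of the Euclidean space. -/
def colSpan {ι κ : Type*} [Fintype ι] [Fintype κ] [DecidableEq ι] [DecidableEq κ]
    (B : Matrix ι κ ℂ) : Submodule ℂ (EuclideanSpace ℂ ι) :=
  LinearMap.range (Matrix.toEuclideanLin B)

/-- `U` is an invariant subspace of `A`, that is, `AU ⊆ U`. -/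
def IsInvariantSubspace {ι : Type*} [Fintype ι] [DecidableEq ι] (A : Matrix ι ι ℂ)
    (U : Submodule ℂ (EuclideanSpace ℂ ι)) : Prop :=
  U.map (Matrix.toEuclideanLin A) ≤ U

/-- `(X, M)` is a right invariant pair of `A`: `X` has full column rank and `AX = XM`. -/
def IsRightInvariantPair {ι κ : Type*} [Fintype ι] [Fintype κ] (A : Matrix ι ι ℂ)
    (X : Matrix ι κ ℂ) (M : Matrix κ κ ℂ) : Prop :=
  X.rank = Fintype.card κ ∧ A * X = X * M

/-- `(Y, N)` is a left invariant pair of `A`: `Y` has full column rank and `Y*A = NY*`. -/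
def IsLeftInvariantPair {ι κ : Type*} [Fintype ι] [Fintype κ] (A : Matrix ι ι ℂ)
    (Y : Matrix ι κ ℂ) (N : Matrix κ κ ℂ) : Prop :=
  Y.rank = Fintype.card κ ∧ Yᴴ * A = N * Yᴴ

/-- The largest canonical angle `θ_max(U, V) ∈ [0, π/2]` of two nonzero subspaces of the same
dimension, given by `sin θ_max(U, V) = max {‖(I - P_V)u‖₂ : u ∈ U, ‖u‖₂ = 1}`, where `P_V` is the
orthogonal projection onto `V`. -/
def maxAngle {ι : Type*} [Fintype ι] (U V : Submodule ℂ (EuclideanSpace ℂ ι)) : ℝ :=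
  Real.arcsin (sSup {r : ℝ | ∃ u ∈ U, ‖u‖ = 1 ∧ r = ‖u - V.starProjection u‖})

/-- `P` is the spectral projection of `A` corresponding to the set `σ` of eigenvalues: `P` is a
projection that commutes with `A`, the restriction of `A` to the range of `P` has the spectrum `σ`,
and the restriction of `A` to the kernel of `P` has the spectrum `eig(A) \ σ`. -/
def IsSpectralProjection {ι : Type*} [Fintype ι] [DecidableEq ι] (A : Matrix ι ι ℂ) (σ : Set ℂ)
    (P : Matrix ι ι ℂ) : Prop :=
  P * P = P ∧ P * A = A * P ∧
    {μ : ℂ | ∃ v : ι → ℂ, v ≠ 0 ∧ P *ᵥ v = v ∧ A *ᵥ v = μ • v} = σ ∧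
    {μ : ℂ | ∃ v : ι → ℂ, v ≠ 0 ∧ P *ᵥ v = 0 ∧ A *ᵥ v = μ • v} = spectrum ℂ A \ σ

end

/-! Conjugation by `S` reduces the problem to a perturbation F = S⁻¹ES of diag(A₁₁, A₂₂). With κ =
‖S⁻¹‖‖S‖ = p + ‖R‖ and η = κ‖E‖ one has ‖F‖ ≤ η and 2η < s. The columns of [I; X] span an invariant
subspace of the perturbed matrix exactly when X solves a Riccati equation, so everything turns on
the solutions of that equation in the unit ball.

Three facts control them. First, if the a- and b-pseudospectra of the two blocks meet, then s ≤ a +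
b (`sep_le_add_of_mem_pseudospectrum`); this gives (a). Second, let ‖X‖ ≤ 1 and let u be an
eigenvector of M. Then Xu is not longer than u, and (u, Xu) has residual at most η‖(u, Xu)‖ with
respect to diag(A₁₁, A₂₂); an averaging argument puts the eigenvalue into the η-pseudospectrum of
A₁₁ (`mem_pseudospectrum_of_joint_residual`). Conjugate transposition gives the same for N and A₂₂.
So M(X) and N(Y) have disjoint spectra for any two solutions X, Y in the unit ball. Third, a
Sylvester operator with disjoint spectra is bijective.

The operator Z ↦ N(Y)Z − ZM(X) governs the difference of two solutions and, for Y = X, the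
derivative of the equation at X. Hence solutions are unique, and those for tF can be continued
locally in t. The estimate s‖X‖ ≤ η(1 + ‖X‖²) ≤ 2η confines them to the ball of radius 2η/s < 1, so
the continuation from t = 0 reaches t = 1 (`riccati_exists`).

For the optimality of `S`, a block-diagonalizing U⁻¹ must send the range and the kernel of P to
orthogonal coordinate subspaces; a suitable pair of equally long vectors in the two shows that this
costs a condition number of κ (`add_norm_le_condition`). The angle bounds come from the explicit
bases of the perturbed subspaces and (p + ‖R‖)(p − ‖R‖) = 1. -/

/-- The Euclidean norm of a complex vector. -/
noncomputable def vecNorm {ι : Type*} [Fintype ι] (x : ι → ℂ) : ℝ :=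
  ‖(WithLp.toLp 2 x : EuclideanSpace ℂ ι)‖

/-! ### Euclidean norms of vectors and spectral norms of matrices. -/

section VecNorm

variable {ι κ : Type*} [Fintype ι] [Fintype κ]

lemma vecNorm_nonneg (x : ι → ℂ) : 0 ≤ vecNorm x := norm_nonneg _

lemma vecNorm_sq (x : ι → ℂ) : vecNorm x ^ 2 = ∑ i, ‖x i‖ ^ 2 :=
  EuclideanSpace.norm_sq_eq _

@[simp] lemma vecNorm_zero : vecNorm (0 : ι → ℂ) = 0 := by simp [vecNorm]

lemma vecNorm_eq_zero {x : ι → ℂ} : vecNorm x = 0 ↔ x = 0 := by simp [vecNorm]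

lemma vecNorm_pos {x : ι → ℂ} (hx : x ≠ 0) : 0 < vecNorm x :=
  lt_of_le_of_ne (vecNorm_nonneg x) fun h => hx (vecNorm_eq_zero.1 h.symm)

lemma vecNorm_smul (c : ℂ) (x : ι → ℂ) : vecNorm (c • x) = ‖c‖ * vecNorm x := by
  simp [vecNorm, norm_smul]

lemma vecNorm_neg (x : ι → ℂ) : vecNorm (-x) = vecNorm x := by simp [vecNorm]

lemma vecNorm_add_le (x y : ι → ℂ) : vecNorm (x + y) ≤ vecNorm x + vecNorm y := by
  simpa [vecNorm] using norm_add_le (WithLp.toLp 2 x : EuclideanSpace ℂ ι) (WithLp.toLp 2 y)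

lemma vecNorm_sub_le (x y : ι → ℂ) : vecNorm (x - y) ≤ vecNorm x + vecNorm y := by
  simpa [vecNorm] using norm_sub_le (WithLp.toLp 2 x : EuclideanSpace ℂ ι) (WithLp.toLp 2 y)

lemma vecNorm_sumElim_sq (x : ι → ℂ) (y : κ → ℂ) :
    vecNorm (Sum.elim x y) ^ 2 = vecNorm x ^ 2 + vecNorm y ^ 2 := by
  simp [vecNorm_sq]

lemma vecNorm_sumElim_zero_right (x : ι → ℂ) : vecNorm (Sum.elim x (0 : κ → ℂ)) = vecNorm x := by
  rw [← sq_eq_sq₀ (vecNorm_nonneg _) (vecNorm_nonneg _), vecNorm_sumElim_sq]; simp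

lemma vecNorm_sumElim_zero_left (y : κ → ℂ) : vecNorm (Sum.elim (0 : ι → ℂ) y) = vecNorm y := by
  rw [← sq_eq_sq₀ (vecNorm_nonneg _) (vecNorm_nonneg _), vecNorm_sumElim_sq]; simp

lemma vecNorm_le_sumElim_left (x : ι → ℂ) (y : κ → ℂ) : vecNorm x ≤ vecNorm (Sum.elim x y) := by
  rw [← sq_le_sq₀ (vecNorm_nonneg _) (vecNorm_nonneg _), vecNorm_sumElim_sq]
  nlinarith [sq_nonneg (vecNorm y)]

lemma star_dotProduct_self (x : ι → ℂ) : star x ⬝ᵥ x = ((vecNorm x ^ 2 : ℝ) : ℂ) := by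
  rw [vecNorm_sq, dotProduct]
  push_cast
  exact Finset.sum_congr rfl fun i _ => by
    simpa using Complex.conj_mul' (x i)

lemma norm_star_dotProduct_le (x y : ι → ℂ) : ‖star x ⬝ᵥ y‖ ≤ vecNorm x * vecNorm y := by
  have := norm_inner_le_norm (𝕜 := ℂ) (WithLp.toLp 2 x : EuclideanSpace ℂ ι) (WithLp.toLp 2 y)
  rwa [EuclideanSpace.inner_toLp_toLp, dotProduct_comm] at this

lemma vecNorm_mulVec_le [DecidableEq κ] (A : Matrix ι κ ℂ) (x : κ → ℂ) :
    vecNorm (A *ᵥ x) ≤ ‖A‖ * vecNorm x :=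
  A.l2_opNorm_mulVec (WithLp.toLp 2 x)

lemma Matrix.l2_opNorm_le_of_vecNorm [DecidableEq κ] {A : Matrix ι κ ℂ} {c : ℝ} (hc : 0 ≤ c)
    (h : ∀ x, vecNorm (A *ᵥ x) ≤ c * vecNorm x) : ‖A‖ ≤ c := by
  rw [Matrix.l2_opNorm_def]
  exact ContinuousLinearMap.opNorm_le_bound _ hc fun x => h x.ofLp

lemma Matrix.exists_vecNorm_mulVec_eq [DecidableEq κ] [Nonempty κ] (A : Matrix ι κ ℂ) :
    ∃ x, vecNorm x = 1 ∧ vecNorm (A *ᵥ x) = ‖A‖ := by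
  have hne : (Metric.sphere (0 : EuclideanSpace ℂ κ) 1).Nonempty :=
    NormedSpace.sphere_nonempty.2 zero_le_one
  obtain ⟨x, hx, hmax⟩ := (isCompact_sphere (0 : EuclideanSpace ℂ κ) 1).exists_isMaxOn hne
    (f := fun x => ‖(Matrix.toEuclideanLin.trans LinearMap.toContinuousLinearMap A) x‖)
    (by fun_prop)
  have hx1 : vecNorm x.ofLp = 1 := by simpa [vecNorm] using hx
  refine ⟨x.ofLp, hx1, le_antisymm ?_ ?_⟩
  · simpa [hx1] using vecNorm_mulVec_le A x.ofLp
  · refine Matrix.l2_opNorm_le_of_vecNorm (vecNorm_nonneg _) fun y => ?_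
    rcases eq_or_ne y 0 with rfl | hy
    · simp
    have hpos := vecNorm_pos hy
    set z : κ → ℂ := ((vecNorm y : ℂ)⁻¹) • y with hz
    have hz1 : vecNorm z = 1 := by
      rw [hz, vecNorm_smul]; simp [abs_of_pos hpos, hpos.ne']
    have hle : vecNorm (A *ᵥ z) ≤ vecNorm (A *ᵥ x.ofLp) :=
      hmax (a := WithLp.toLp 2 z) (by simpa [vecNorm] using hz1)
    have : vecNorm (A *ᵥ z) = (vecNorm y)⁻¹ * vecNorm (A *ᵥ y) := by
      rw [hz, Matrix.mulVec_smul, vecNorm_smul]; simp [abs_of_pos hpos]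
    rw [this, inv_mul_le_iff₀ hpos] at hle
    linarith

lemma Matrix.l2_opNorm_vecMulVec_star [DecidableEq κ] (y : ι → ℂ) (x : κ → ℂ) :
    ‖Matrix.vecMulVec y (star x)‖ = vecNorm y * vecNorm x := by
  have key : ∀ z, Matrix.vecMulVec y (star x) *ᵥ z = (star x ⬝ᵥ z) • y := fun z => by
    rw [Matrix.vecMulVec_mulVec]; ext i; simp [mul_comm]
  apply le_antisymm
  · refine Matrix.l2_opNorm_le_of_vecNorm (mul_nonneg (vecNorm_nonneg _) (vecNorm_nonneg _))
      fun z => ?_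
    rw [key, vecNorm_smul]
    nlinarith [norm_star_dotProduct_le x z, vecNorm_nonneg y]
  · rcases eq_or_ne x 0 with rfl | hx
    · simp
    have hpos := vecNorm_pos hx
    have h := vecNorm_mulVec_le (Matrix.vecMulVec y (star x)) x
    rw [key, star_dotProduct_self, vecNorm_smul, Complex.norm_real, Real.norm_of_nonneg
      (sq_nonneg _)] at h
    refine le_of_mul_le_mul_right ?_ hpos
    linarith

lemma Matrix.mem_spectrum_iff_exists_mulVec [DecidableEq ι] {A : Matrix ι ι ℂ} {z : ℂ} :
    z ∈ spectrum ℂ A ↔ ∃ v, v ≠ 0 ∧ A *ᵥ v = z • v := by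
  rw [spectrum.mem_iff, Matrix.isUnit_iff_isUnit_det, isUnit_iff_ne_zero, not_not,
    ← Matrix.exists_mulVec_eq_zero_iff]
  refine exists_congr fun v => and_congr_right fun _ => ?_
  rw [Matrix.sub_mulVec, sub_eq_zero, Algebra.algebraMap_eq_smul_one, Matrix.smul_mulVec,
    Matrix.one_mulVec, eq_comm]

lemma Matrix.conjTranspose_mem_spectrum_iff [DecidableEq ι] {A : Matrix ι ι ℂ} {z : ℂ} :
    star z ∈ spectrum ℂ Aᴴ ↔ z ∈ spectrum ℂ A := by
  rw [← Matrix.star_eq_conjTranspose, spectrum.map_star, Set.star_mem_star]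

end VecNorm

/-! ### The separation and Sylvester equations. -/

section Sep

variable {m k : ℕ} {A : Matrix (Fin k) (Fin k) ℂ} {B : Matrix (Fin m) (Fin m) ℂ}

lemma sep_mul_norm_le (A : Matrix (Fin k) (Fin k) ℂ) (B : Matrix (Fin m) (Fin m) ℂ)
    (X : Matrix (Fin k) (Fin m) ℂ) : sep A B * ‖X‖ ≤ ‖A * X - X * B‖ := by
  rcases eq_or_ne X 0 with rfl | hX
  · simp
  have hpos : 0 < ‖X‖ := norm_pos_iff.2 hX
  have hbdd : BddBelow {r : ℝ | ∃ X : Matrix (Fin k) (Fin m) ℂ, ‖X‖ = 1 ∧ r = ‖A * X - X * B‖} :=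
    ⟨0, by rintro _ ⟨X, -, rfl⟩; exact norm_nonneg _⟩
  have h : sep A B ≤ ‖A * ((‖X‖ : ℂ)⁻¹ • X) - ((‖X‖ : ℂ)⁻¹ • X) * B‖ :=
    csInf_le hbdd ⟨(‖X‖ : ℂ)⁻¹ • X, by rw [norm_smul]; simp [hpos.ne'], rfl⟩
  rw [Matrix.mul_smul, Matrix.smul_mul, ← smul_sub, norm_smul, norm_inv, Complex.norm_real,
    norm_norm, le_inv_mul_iff₀ hpos] at h
  linarith

lemma eq_zero_of_sep_pos (hs : 0 < sep A B) {X : Matrix (Fin k) (Fin m) ℂ}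
    (h : A * X = X * B) : X = 0 := by
  have := sep_mul_norm_le A B X
  rw [h, sub_self, norm_zero] at this
  exact norm_le_zero_iff.1 (nonpos_of_mul_nonpos_right this hs)

/-- For an empty block there is no matrix of norm 1, and the infimum of the empty set is 0. Thus the
condition 1 ≤ m < n need not be assumed separately. -/
lemma nonempty_of_sep_pos (hs : 0 < sep A B) : Nonempty (Fin k) ∧ Nonempty (Fin m) := by
  by_contra hcon
  have hempty : ∀ X : Matrix (Fin k) (Fin m) ℂ, X = 0 := fun X => by
    ext i j; exact absurd ⟨⟨i⟩, ⟨j⟩⟩ hcon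
  have : {r : ℝ | ∃ X : Matrix (Fin k) (Fin m) ℂ, ‖X‖ = 1 ∧ r = ‖A * X - X * B‖} = ∅ := by
    ext r
    simp only [Set.mem_ofPred_eq, Set.mem_empty_iff_false, iff_false]
    rintro ⟨X, hX, -⟩
    rw [hempty X] at hX
    simp at hX
  rw [sep, this, Real.sInf_empty] at hs
  exact lt_irrefl _ hs

/-- The operator `X ↦ AX - XB`. -/
def sylvesterMap {ι κ : Type*} [Fintype ι] [Fintype κ] (A : Matrix ι ι ℂ) (B : Matrix κ κ ℂ) :
    Matrix ι κ ℂ →ₗ[ℂ] Matrix ι κ ℂ where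
  toFun X := A * X - X * B
  map_add' X Y := by simp only [Matrix.mul_add, Matrix.add_mul]; abel
  map_smul' c X := by simp [smul_sub]

@[simp] lemma sylvesterMap_apply {ι κ : Type*} [Fintype ι] [Fintype κ] (A : Matrix ι ι ℂ)
    (B : Matrix κ κ ℂ) (X : Matrix ι κ ℂ) : sylvesterMap A B X = A * X - X * B := rfl

lemma sylvesterMap_bijective_of_injective {ι κ : Type*} [Fintype ι] [Fintype κ]
    {A : Matrix ι ι ℂ} {B : Matrix κ κ ℂ} (h : ∀ X : Matrix ι κ ℂ, A * X = X * B → X = 0) :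
    Function.Bijective (sylvesterMap A B) := by
  have hinj : Function.Injective (sylvesterMap A B) := by
    rw [injective_iff_map_eq_zero]
    intro X hX
    exact h X (sub_eq_zero.1 hX)
  exact ⟨hinj, LinearMap.injective_iff_surjective.1 hinj⟩

open scoped ComplexOrder in
/-- Uniqueness for `AX = XB` passes to `BR = RA`, since the two Sylvester operators are
transposes of each other with respect to the trace pairing. -/
lemma eq_zero_of_mul_eq_mul_swap {ι κ : Type*} [Fintype ι] [Fintype κ] [DecidableEq ι]
    [DecidableEq κ] {A : Matrix ι ι ℂ} {B : Matrix κ κ ℂ}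
    (h : ∀ X : Matrix ι κ ℂ, A * X = X * B → X = 0)
    {R : Matrix κ ι ℂ} (hR : B * R = R * A) : R = 0 := by
  have htr : ∀ Y : Matrix ι κ ℂ, (R * Y).trace = 0 := fun Y => by
    obtain ⟨X, rfl⟩ := (sylvesterMap_bijective_of_injective h).2 Y
    rw [sylvesterMap_apply, Matrix.mul_sub, Matrix.trace_sub, ← Matrix.mul_assoc, ← hR,
      ← Matrix.mul_assoc R X B, Matrix.trace_mul_comm (R * X) B, Matrix.mul_assoc, sub_self]
  have := htr Rᴴ
  rwa [Matrix.trace_mul_conjTranspose_self_eq_zero_iff] at this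

lemma existsUnique_sylvester {ι κ : Type*} [Fintype ι] [Fintype κ] [DecidableEq ι]
    [DecidableEq κ] {A : Matrix ι ι ℂ} {B : Matrix κ κ ℂ}
    (h : ∀ X : Matrix ι κ ℂ, A * X = X * B → X = 0)
    (C : Matrix κ ι ℂ) : ∃! R : Matrix κ ι ℂ, B * R - R * A = C :=
  (sylvesterMap_bijective_of_injective fun _ => eq_zero_of_mul_eq_mul_swap h).existsUnique C

/-- Matrices without a common eigenvalue are not intertwined by a nonzero matrix. -/
lemma eq_zero_of_disjoint_spectrum {ι κ : Type*} [Fintype ι] [Fintype κ] [DecidableEq ι]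
    [DecidableEq κ] {A : Matrix ι ι ℂ} {B : Matrix κ κ ℂ}
    (h : Disjoint (spectrum ℂ A) (spectrum ℂ B)) {X : Matrix ι κ ℂ} (hX : A * X = X * B) :
    X = 0 := by
  have hpow : ∀ p : Polynomial ℂ, p.aeval A * X = X * p.aeval B := by
    intro p
    induction p using Polynomial.induction_on with
    | C a => simp [Algebra.algebraMap_eq_smul_one]
    | add p q hp hq => simp [Matrix.add_mul, Matrix.mul_add, hp, hq]
    | monomial n a ih =>
      simp only [pow_succ, ← mul_assoc, map_mul, Polynomial.aeval_X] at ih ⊢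
      rw [Matrix.mul_assoc, hX, ← Matrix.mul_assoc, ih, Matrix.mul_assoc]
  -- By spectral mapping, χ_B(A) is singular only if A has an eigenvalue that is a root of χ_B.
  -- Cayley–Hamilton then gives χ_B(A)X = Xχ_B(B) = 0.
  have hu : IsUnit (B.charpoly.aeval A) := by
    by_contra hcon
    rcases isEmpty_or_nonempty ι with hι | hι
    · exact hcon (isUnit_of_subsingleton _)
    have h0 : (0 : ℂ) ∈ spectrum ℂ (B.charpoly.aeval A) := by
      rwa [spectrum.zero_mem_iff]
    rw [spectrum.map_polynomial_aeval] at h0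
    obtain ⟨z, hz, hz0⟩ := h0
    refine Set.disjoint_left.1 h hz ?_
    rw [Matrix.mem_spectrum_iff_isRoot_charpoly]
    exact hz0
  have h1 := hpow B.charpoly
  rw [Matrix.aeval_self_charpoly, Matrix.mul_zero] at h1
  obtain ⟨u, hu⟩ := hu
  rw [← hu] at h1
  calc X = (↑u⁻¹ * (u : Matrix ι ι ℂ)) * X := by simp
    _ = 0 := by rw [Matrix.mul_assoc, h1, Matrix.mul_zero]

end Sep

/-! ### Pseudospectra, residuals and the separation. -/

section Pseudospectrum

variable {m k : ℕ} {A : Matrix (Fin k) (Fin k) ℂ} {B : Matrix (Fin m) (Fin m) ℂ}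

lemma spectrum_subset_pseudospectrum {ε : ℝ} (hε : 0 ≤ ε) (A : Matrix (Fin k) (Fin k) ℂ) :
    spectrum ℂ A ⊆ pseudospectrum ε A :=
  fun z hz => by
  refine ⟨0, ?_, by simpa using hz⟩
  rwa [norm_zero]

/-- The rank-one perturbation −ru*/‖u‖² with r = Au − zu cancels the residual at u, and its norm is
‖r‖/‖u‖. -/
lemma mem_pseudospectrum_of_vecNorm_le {ε : ℝ} {z : ℂ} {u : Fin k → ℂ} (hu : u ≠ 0)
    (h : vecNorm (A *ᵥ u - z • u) ≤ ε * vecNorm u) : z ∈ pseudospectrum ε A := by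
  have hpos := vecNorm_pos hu
  refine ⟨(-((vecNorm u ^ 2 : ℝ) : ℂ)⁻¹) • Matrix.vecMulVec (A *ᵥ u - z • u) (star u), ?_, ?_⟩
  · rw [norm_smul, Matrix.l2_opNorm_vecMulVec_star, norm_neg, norm_inv, Complex.norm_real,
      Real.norm_of_nonneg (sq_nonneg _), inv_mul_le_iff₀ (by positivity)]
    nlinarith
  · rw [Matrix.mem_spectrum_iff_exists_mulVec]
    refine ⟨u, hu, ?_⟩
    have hne : ((vecNorm u ^ 2 : ℝ) : ℂ) ≠ 0 := by
      exact_mod_cast (pow_pos hpos 2).ne'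
    have : Matrix.vecMulVec (A *ᵥ u - z • u) (star u) *ᵥ u
        = ((vecNorm u ^ 2 : ℝ) : ℂ) • (A *ᵥ u - z • u) := by
      rw [Matrix.vecMulVec_mulVec, star_dotProduct_self]; ext i; simp [mul_comm]
    rw [Matrix.add_mulVec, Matrix.smul_mulVec, this, neg_smul, smul_smul, inv_mul_cancel₀ hne,
      one_smul]
    abel

lemma exists_vecNorm_le_of_mem_pseudospectrum {ε : ℝ} {z : ℂ} (h : z ∈ pseudospectrum ε A) :
    ∃ u, u ≠ 0 ∧ vecNorm (A *ᵥ u - z • u) ≤ ε * vecNorm u := by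
  obtain ⟨F, hF, hz⟩ := h
  obtain ⟨u, hu, hz⟩ := Matrix.mem_spectrum_iff_exists_mulVec.1 hz
  refine ⟨u, hu, ?_⟩
  have : A *ᵥ u - z • u = -(F *ᵥ u) := by rw [← hz, Matrix.add_mulVec]; abel
  rw [this, vecNorm_neg]
  exact (vecNorm_mulVec_le F u).trans (mul_le_mul_of_nonneg_right hF (vecNorm_nonneg u))

lemma conjTranspose_mem_pseudospectrum {ε : ℝ} {z : ℂ} (h : z ∈ pseudospectrum ε A) :
    star z ∈ pseudospectrum ε Aᴴ := by
  obtain ⟨F, hF, hz⟩ := h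
  refine ⟨Fᴴ, by rwa [Matrix.l2_opNorm_conjTranspose], ?_⟩
  rwa [← Matrix.conjTranspose_add, Matrix.conjTranspose_mem_spectrum_iff]

lemma conjTranspose_mem_pseudospectrum_iff {ε : ℝ} {z : ℂ} :
    star z ∈ pseudospectrum ε Aᴴ ↔ z ∈ pseudospectrum ε A := by
  refine ⟨fun h => ?_, conjTranspose_mem_pseudospectrum⟩
  simpa using conjTranspose_mem_pseudospectrum h

/-- The separation is at most `a + b` if the `a`- and `b`-pseudospectra meet. -/
lemma sep_le_add_of_mem_pseudospectrum {a b : ℝ} {z : ℂ} (hA : z ∈ pseudospectrum a A)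
    (hB : z ∈ pseudospectrum b B) : sep A B ≤ a + b := by
  obtain ⟨y, hy, hyA⟩ := exists_vecNorm_le_of_mem_pseudospectrum hA
  obtain ⟨x, hx, hxB⟩ :=
    exists_vecNorm_le_of_mem_pseudospectrum (conjTranspose_mem_pseudospectrum hB)
  have hypos := vecNorm_pos hy
  have hxpos := vecNorm_pos hx
  -- The test matrix is yx*, where y is an approximate right eigenvector of A and x an approximate
  -- left eigenvector of B for the same z. The terms zyx* cancel, and only the two residuals remain.
  have h := sep_mul_norm_le A B (Matrix.vecMulVec y (star x))
  have hsplit : A * Matrix.vecMulVec y (star x) - Matrix.vecMulVec y (star x) * B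
      = Matrix.vecMulVec (A *ᵥ y - z • y) (star x)
        - Matrix.vecMulVec y (star (Bᴴ *ᵥ x - star z • x)) := by
    rw [Matrix.mul_vecMulVec, Matrix.vecMulVec_mul, star_sub, Matrix.star_mulVec,
      Matrix.conjTranspose_conjTranspose, star_smul, star_star, Matrix.sub_vecMulVec,
      Matrix.vecMulVec_sub, Matrix.smul_vecMulVec, Matrix.vecMulVec_smul]
    abel
  rw [hsplit, Matrix.l2_opNorm_vecMulVec_star] at h
  have h2 := norm_sub_le (Matrix.vecMulVec (A *ᵥ y - z • y) (star x))
    (Matrix.vecMulVec y (star (Bᴴ *ᵥ x - star z • x)))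
  rw [Matrix.l2_opNorm_vecMulVec_star, Matrix.l2_opNorm_vecMulVec_star] at h2
  refine le_of_mul_le_mul_right ?_ (mul_pos hypos hxpos)
  nlinarith [mul_le_mul_of_nonneg_right hyA hxpos.le, mul_le_mul_of_nonneg_left hxB hypos.le]

/-- If a joint residual of `(u, w)` is small, `w` is not longer than `u`, and the separation is
larger than `2η`, then the eigenvalue belongs to the first block. -/
lemma mem_pseudospectrum_of_joint_residual {η : ℝ} (hη : 0 ≤ η)
    (hsep : ∀ a b z, z ∈ pseudospectrum a A → z ∈ pseudospectrum b B → 2 * η < a + b) {z : ℂ}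
    {u : Fin k → ℂ} {w : Fin m → ℂ} (hu : u ≠ 0) (hwu : vecNorm w ≤ vecNorm u)
    (h : vecNorm (A *ᵥ u - z • u) ^ 2 + vecNorm (B *ᵥ w - z • w) ^ 2
      ≤ η ^ 2 * (vecNorm u ^ 2 + vecNorm w ^ 2)) : z ∈ pseudospectrum η A := by
  have hupos := vecNorm_pos hu
  -- Let a and b be the relative residuals of u and w. If a > η, then the excess a² − η², weighted
  -- by ‖u‖² ≥ ‖w‖², has to be offset by η² − b², so a² + b² ≤ 2η². Then a + b ≤ 2η, contrary to
  -- `hsep`.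
  by_contra hcon
  have ha : η * vecNorm u < vecNorm (A *ᵥ u - z • u) := by
    by_contra hle
    exact hcon (mem_pseudospectrum_of_vecNorm_le hu (not_lt.1 hle))
  have ha2 : η ^ 2 * vecNorm u ^ 2 < vecNorm (A *ᵥ u - z • u) ^ 2 := by
    rw [← mul_pow]; exact pow_lt_pow_left₀ ha (by positivity) two_ne_zero
  have hw : w ≠ 0 := by
    rintro rfl
    simp at h
    linarith
  have hwpos := vecNorm_pos hw
  set a := vecNorm (A *ᵥ u - z • u) / vecNorm u with ha_def
  set b := vecNorm (B *ᵥ w - z • w) / vecNorm w with hb_def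
  have ea : vecNorm (A *ᵥ u - z • u) = a * vecNorm u := by rw [ha_def]; field_simp
  have eb : vecNorm (B *ᵥ w - z • w) = b * vecNorm w := by rw [hb_def]; field_simp
  have ha0 : 0 ≤ a := div_nonneg (vecNorm_nonneg _) hupos.le
  have hb0 : 0 ≤ b := div_nonneg (vecNorm_nonneg _) hwpos.le
  have hab := hsep a b z (mem_pseudospectrum_of_vecNorm_le hu ea.le)
    (mem_pseudospectrum_of_vecNorm_le hw eb.le)
  rw [ea] at ha
  rw [ea, eb] at h
  have haη : η < a := lt_of_mul_lt_mul_right ha hupos.le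
  have h3 : (a ^ 2 - η ^ 2) * vecNorm u ^ 2 ≤ (η ^ 2 - b ^ 2) * vecNorm w ^ 2 := by nlinarith
  have hpa : 0 < a ^ 2 - η ^ 2 := by nlinarith
  have hw2 : vecNorm w ^ 2 ≤ vecNorm u ^ 2 := pow_le_pow_left₀ hwpos.le hwu 2
  have h4 : (a ^ 2 - η ^ 2) * vecNorm w ^ 2 ≤ (η ^ 2 - b ^ 2) * vecNorm w ^ 2 :=
    (mul_le_mul_of_nonneg_left hw2 hpa.le).trans h3
  have h5 : a ^ 2 - η ^ 2 ≤ η ^ 2 - b ^ 2 := le_of_mul_le_mul_right h4 (pow_pos hwpos 2)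
  nlinarith [sq_nonneg (a - b)]

end Pseudospectrum

/-! ### The spectral projection and optimally conditioned block diagonalization. -/

section BlockDiagonalization

variable {ι κ : Type*} [Fintype ι] [Fintype κ] [DecidableEq ι] [DecidableEq κ]

omit [DecidableEq ι] [DecidableEq κ] in
lemma Matrix.fromBlocks_mulVec_elim {ι' κ' : Type*} (A : Matrix ι' ι ℂ) (B : Matrix ι' κ ℂ)
    (C : Matrix κ' ι ℂ) (D : Matrix κ' κ ℂ) (x : ι → ℂ) (y : κ → ℂ) :
    Matrix.fromBlocks A B C D *ᵥ Sum.elim x y = Sum.elim (A *ᵥ x + B *ᵥ y) (C *ᵥ x + D *ᵥ y) := by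
  rw [Matrix.fromBlocks_mulVec]; rfl

lemma Matrix.l2_opNorm_fromBlocks_le {A : Matrix ι ι ℂ} {B : Matrix ι κ ℂ} {C : Matrix κ ι ℂ}
    {D : Matrix κ κ ℂ} {c : ℝ} (hc : 0 ≤ c)
    (h : ∀ x y, vecNorm (A *ᵥ x + B *ᵥ y) ^ 2 + vecNorm (C *ᵥ x + D *ᵥ y) ^ 2
      ≤ c ^ 2 * (vecNorm x ^ 2 + vecNorm y ^ 2)) : ‖Matrix.fromBlocks A B C D‖ ≤ c := by
  refine Matrix.l2_opNorm_le_of_vecNorm hc fun v => ?_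
  rw [← Sum.elim_comp_inl_inr v, Matrix.fromBlocks_mulVec_elim,
    ← sq_le_sq₀ (vecNorm_nonneg _) (mul_nonneg hc (vecNorm_nonneg _)), mul_pow,
    vecNorm_sumElim_sq, vecNorm_sumElim_sq]
  exact h _ _

/-- The norm of an oblique projection with block row `[I, -R]`. -/
lemma Matrix.l2_opNorm_obliqueProjection [Nonempty ι] (R : Matrix ι κ ℂ) :
    ‖(Matrix.fromBlocks 1 (-R) 0 0 : Matrix (ι ⊕ κ) (ι ⊕ κ) ℂ)‖ = √(1 + ‖R‖ ^ 2) := by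
  have hq : √(1 + ‖R‖ ^ 2) ^ 2 = 1 + ‖R‖ ^ 2 := Real.sq_sqrt (by positivity)
  apply le_antisymm
  · refine Matrix.l2_opNorm_fromBlocks_le (Real.sqrt_nonneg _) fun x y => ?_
    rw [hq, Matrix.one_mulVec, Matrix.neg_mulVec, ← sub_eq_add_neg]
    have h1 : vecNorm (x - R *ᵥ y) ≤ vecNorm x + ‖R‖ * vecNorm y :=
      (vecNorm_sub_le _ _).trans (by gcongr; exact vecNorm_mulVec_le R y)
    have h2 := pow_le_pow_left₀ (vecNorm_nonneg _) h1 2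
    simp only [Matrix.zero_mulVec, add_zero, vecNorm_zero]
    nlinarith [sq_nonneg (‖R‖ * vecNorm x - vecNorm y)]
  -- The extremal vector is [z; −R*z] = P*[z; 0], with z maximizing ‖R*z‖. Its length is √(1 +
  -- ‖R‖²), and the first block of its image has inner product 1 + ‖R‖² with z.
  · obtain ⟨z, hz, hRz⟩ := Matrix.exists_vecNorm_mulVec_eq Rᴴ
    rw [Matrix.l2_opNorm_conjTranspose] at hRz
    have h := vecNorm_mulVec_le (Matrix.fromBlocks 1 (-R) 0 0 : Matrix (ι ⊕ κ) (ι ⊕ κ) ℂ)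
      (Sum.elim z (-(Rᴴ *ᵥ z)))
    have hv : vecNorm (Sum.elim z (-(Rᴴ *ᵥ z))) = √(1 + ‖R‖ ^ 2) := by
      rw [← sq_eq_sq₀ (vecNorm_nonneg _) (Real.sqrt_nonneg _), vecNorm_sumElim_sq, vecNorm_neg, hz,
        hRz, hq, one_pow]
    rw [hv, Matrix.fromBlocks_mulVec_elim] at h
    have h1 := (vecNorm_le_sumElim_left _ _).trans h
    have h2 := norm_star_dotProduct_le z ((1 : Matrix ι ι ℂ) *ᵥ z + -R *ᵥ -(Rᴴ *ᵥ z))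
    have h3 : star z ⬝ᵥ ((1 : Matrix ι ι ℂ) *ᵥ z + -R *ᵥ -(Rᴴ *ᵥ z))
        = ((1 + ‖R‖ ^ 2 : ℝ) : ℂ) := by
      have : star z ⬝ᵥ R *ᵥ (Rᴴ *ᵥ z) = star (Rᴴ *ᵥ z) ⬝ᵥ (Rᴴ *ᵥ z) := by
        rw [Matrix.star_mulVec, Matrix.conjTranspose_conjTranspose, Matrix.dotProduct_mulVec]
      rw [Matrix.one_mulVec, Matrix.mulVec_neg, Matrix.neg_mulVec, neg_neg, dotProduct_add, this,
        star_dotProduct_self, star_dotProduct_self, hz, hRz]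
      push_cast; ring
    rw [h3, Complex.norm_real, Real.norm_of_nonneg (by positivity), hz, one_mul] at h2
    have hpos : 0 < √(1 + ‖R‖ ^ 2) := Real.sqrt_pos.2 (by positivity)
    refine le_of_mul_le_mul_right ?_ hpos
    nlinarith

/-- The range of P consists of the vectors [x; 0], where A acts as A₁₁. Its kernel consists of the
vectors [Ry; y], where A acts as A₂₂ by the Sylvester equation. Disjointness makes eig(A₂₂) the
exact complement of eig(A₁₁) in eig(A). -/
lemma isSpectralProjection_obliqueProjection {A₁₁ : Matrix ι ι ℂ} {A₁₂ R : Matrix ι κ ℂ}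
    {A₂₂ : Matrix κ κ ℂ} (hR : A₁₁ * R - R * A₂₂ = -A₁₂)
    (hdisj : Disjoint (spectrum ℂ A₁₁) (spectrum ℂ A₂₂)) :
    IsSpectralProjection (Matrix.fromBlocks A₁₁ A₁₂ 0 A₂₂) (spectrum ℂ A₁₁)
      (Matrix.fromBlocks 1 (-R) 0 0) := by
  have hA12 : A₁₂ = R * A₂₂ - A₁₁ * R := by rw [← neg_sub, hR, neg_neg]
  have hker : {μ : ℂ | ∃ v : ι ⊕ κ → ℂ, v ≠ 0 ∧
      (Matrix.fromBlocks 1 (-R) 0 0 : Matrix (ι ⊕ κ) (ι ⊕ κ) ℂ) *ᵥ v = 0 ∧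
      Matrix.fromBlocks A₁₁ A₁₂ 0 A₂₂ *ᵥ v = μ • v} = spectrum ℂ A₂₂ := by
    ext μ
    rw [Matrix.mem_spectrum_iff_exists_mulVec]
    constructor
    · rintro ⟨v, hv, hPv, hAv⟩
      obtain ⟨x, y, rfl⟩ : ∃ x y, v = Sum.elim x y := ⟨_, _, (Sum.elim_comp_inl_inr v).symm⟩
      rw [Matrix.fromBlocks_mulVec_elim] at hPv hAv
      have hx : x = R *ᵥ y := by
        have : (1 : Matrix ι ι ℂ) *ᵥ x + -R *ᵥ y = 0 := by
          ext i; exact congrFun hPv (Sum.inl i)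
        rw [Matrix.one_mulVec, Matrix.neg_mulVec, ← sub_eq_add_neg] at this
        exact sub_eq_zero.1 this
      refine ⟨y, ?_, ?_⟩
      · rintro rfl
        apply hv
        rw [hx, Matrix.mulVec_zero]
        ext (i | i) <;> rfl
      · ext i
        simpa using congrFun hAv (Sum.inr i)
    · rintro ⟨y, hy, hAy⟩
      refine ⟨Sum.elim (R *ᵥ y) y, fun h => hy ?_, ?_, ?_⟩
      · ext i; exact congrFun h (Sum.inr i)
      · rw [Matrix.fromBlocks_mulVec_elim]
        ext (i | i) <;> simp [Matrix.neg_mulVec]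
      · rw [Matrix.fromBlocks_mulVec_elim, hA12, Matrix.sub_mulVec, ← Matrix.mulVec_mulVec,
          ← Matrix.mulVec_mulVec, add_sub_cancel, hAy, Matrix.mulVec_smul]
        ext (i | i) <;> simp
  refine ⟨?_, ?_, ?_, ?_⟩
  · simp [Matrix.fromBlocks_multiply]
  · simp [Matrix.fromBlocks_multiply, hA12]
    abel
  · ext μ
    rw [Matrix.mem_spectrum_iff_exists_mulVec]
    constructor
    · rintro ⟨v, hv, hPv, hAv⟩
      obtain ⟨x, y, rfl⟩ : ∃ x y, v = Sum.elim x y := ⟨_, _, (Sum.elim_comp_inl_inr v).symm⟩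
      rw [Matrix.fromBlocks_mulVec_elim] at hPv hAv
      have hy : y = 0 := by
        ext i; simpa using (congrFun hPv (Sum.inr i)).symm
      subst hy
      refine ⟨x, ?_, ?_⟩
      · rintro rfl
        exact hv (by ext (i | i) <;> rfl)
      · ext i
        simpa using congrFun hAv (Sum.inl i)
    · rintro ⟨x, hx, hAx⟩
      refine ⟨Sum.elim x 0, fun h => hx ?_, ?_, ?_⟩
      · ext i; exact congrFun h (Sum.inl i)
      · rw [Matrix.fromBlocks_mulVec_elim]
        ext (i | i) <;> simp
      · rw [Matrix.fromBlocks_mulVec_elim, hAx]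
        ext (i | i) <;> simp
  · rw [hker]
    have hspec : spectrum ℂ (Matrix.fromBlocks A₁₁ A₁₂ 0 A₂₂)
        = spectrum ℂ A₁₁ ∪ spectrum ℂ A₂₂ := by
      ext μ
      simp only [Set.mem_union, Matrix.mem_spectrum_iff_isRoot_charpoly,
        Matrix.charpoly_fromBlocks_zero₂₁, Polynomial.root_mul]
    rw [hspec, Set.union_sdiff_left, hdisj.sdiff_eq_right]

lemma conditionBlock_inv_mul {R : Matrix ι κ ℂ} {p : ℂ} (hp : p ≠ 0) :
    (Matrix.fromBlocks 1 (-R) 0 (p • 1) : Matrix (ι ⊕ κ) (ι ⊕ κ) ℂ)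
      * Matrix.fromBlocks 1 (p⁻¹ • R) 0 (p⁻¹ • 1) = 1 := by
  simp [Matrix.fromBlocks_multiply, smul_smul, hp, Matrix.fromBlocks_one]

lemma conditionBlock_inv {R : Matrix ι κ ℂ} {p : ℂ} (hp : p ≠ 0) :
    (Matrix.fromBlocks 1 (p⁻¹ • R) 0 (p⁻¹ • 1) : Matrix (ι ⊕ κ) (ι ⊕ κ) ℂ)⁻¹
      = Matrix.fromBlocks 1 (-R) 0 (p • 1) :=
  Matrix.inv_eq_left_inv (conditionBlock_inv_mul hp)

lemma conditionBlock_isUnit {R : Matrix ι κ ℂ} {p : ℂ} (hp : p ≠ 0) :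
    IsUnit (Matrix.fromBlocks 1 (p⁻¹ • R) 0 (p⁻¹ • 1) : Matrix (ι ⊕ κ) (ι ⊕ κ) ℂ) := by
  have h := conditionBlock_inv_mul (R := R) hp
  exact ⟨⟨_, _, mul_eq_one_comm.1 h, h⟩, rfl⟩

lemma conditionBlock_conj {A₁₁ : Matrix ι ι ℂ} {A₁₂ R : Matrix ι κ ℂ} {A₂₂ : Matrix κ κ ℂ}
    (hR : A₁₁ * R - R * A₂₂ = -A₁₂) {p : ℂ} (hp : p ≠ 0) :
    (Matrix.fromBlocks 1 (-R) 0 (p • 1) : Matrix (ι ⊕ κ) (ι ⊕ κ) ℂ)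
      * Matrix.fromBlocks A₁₁ A₁₂ 0 A₂₂ * Matrix.fromBlocks 1 (p⁻¹ • R) 0 (p⁻¹ • 1)
      = Matrix.fromBlocks A₁₁ 0 0 A₂₂ := by
  have hA12 : A₁₂ = R * A₂₂ - A₁₁ * R := by rw [← neg_sub, hR, neg_neg]
  simp [Matrix.fromBlocks_multiply, smul_smul, hp, hA12, smul_sub]
  abel

/-- With r = ‖R‖, the matrix is majorized by the 2×2 matrix [1, r/p; 0, 1/p]. Scaling by 1/p makes
its second column a unit vector, so its Gram matrix [1, r/p; r/p, 1] has largest eigenvalue 1 + r/p.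
-/
lemma norm_conditionBlock_le {R : Matrix ι κ ℂ} {p : ℝ} (hp : 0 < p)
    (hpR : p ^ 2 = 1 + ‖R‖ ^ 2) :
    ‖(Matrix.fromBlocks 1 ((p : ℂ)⁻¹ • R) 0 ((p : ℂ)⁻¹ • 1) : Matrix (ι ⊕ κ) (ι ⊕ κ) ℂ)‖
      ≤ √((p + ‖R‖) / p) := by
  have hr := norm_nonneg R
  refine Matrix.l2_opNorm_fromBlocks_le (Real.sqrt_nonneg _) fun x y => ?_
  rw [Real.sq_sqrt (by positivity), Matrix.one_mulVec, Matrix.zero_mulVec, zero_add,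
    Matrix.smul_mulVec, Matrix.smul_mulVec, Matrix.one_mulVec]
  have h0 : vecNorm ((p : ℂ)⁻¹ • y) = vecNorm y / p := by
    rw [vecNorm_smul, norm_inv, Complex.norm_real, Real.norm_of_nonneg hp.le]; ring
  have h1 : vecNorm (x + (p : ℂ)⁻¹ • R *ᵥ y) ≤ vecNorm x + ‖R‖ * vecNorm y / p := by
    refine (vecNorm_add_le _ _).trans ?_
    rw [vecNorm_smul, norm_inv, Complex.norm_real, Real.norm_of_nonneg hp.le, inv_mul_eq_div]
    gcongr
    exact vecNorm_mulVec_le R y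
  have h2 := pow_le_pow_left₀ (vecNorm_nonneg _) h1 2
  rw [h0]
  have h3 : (vecNorm x + ‖R‖ * vecNorm y / p) ^ 2 + (vecNorm y / p) ^ 2
      = vecNorm x ^ 2 + vecNorm y ^ 2 + ‖R‖ / p * (2 * vecNorm x * vecNorm y) := by
    field_simp
    linear_combination (-vecNorm y ^ 2) * hpR
  have h4 : (p + ‖R‖) / p * (vecNorm x ^ 2 + vecNorm y ^ 2)
      = vecNorm x ^ 2 + vecNorm y ^ 2 + ‖R‖ / p * (vecNorm x ^ 2 + vecNorm y ^ 2) := by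
    field_simp
  have h5 : ‖R‖ / p * (2 * vecNorm x * vecNorm y) ≤ ‖R‖ / p * (vecNorm x ^ 2 + vecNorm y ^ 2) :=
    mul_le_mul_of_nonneg_left (two_mul_le_add_sq _ _) (by positivity)
  linarith

lemma norm_conditionBlock_inv_le {R : Matrix ι κ ℂ} {p : ℝ} (hp : 0 < p)
    (hpR : p ^ 2 = 1 + ‖R‖ ^ 2) :
    ‖(Matrix.fromBlocks 1 (-R) 0 ((p : ℂ) • 1) : Matrix (ι ⊕ κ) (ι ⊕ κ) ℂ)‖
      ≤ √(p * (p + ‖R‖)) := by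
  have hr := norm_nonneg R
  refine Matrix.l2_opNorm_fromBlocks_le (Real.sqrt_nonneg _) fun x y => ?_
  rw [Real.sq_sqrt (by positivity), Matrix.one_mulVec, Matrix.zero_mulVec, zero_add,
    Matrix.neg_mulVec, Matrix.smul_mulVec, Matrix.one_mulVec, ← sub_eq_add_neg, vecNorm_smul,
    Complex.norm_real, Real.norm_of_nonneg hp.le]
  have h1 : vecNorm (x - R *ᵥ y) ≤ vecNorm x + ‖R‖ * vecNorm y :=
    (vecNorm_sub_le _ _).trans (by gcongr; exact vecNorm_mulVec_le R y)
  have h2 := pow_le_pow_left₀ (vecNorm_nonneg _) h1 2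
  -- Since (p + ‖R‖)(p − ‖R‖) = 1, the quadratic form on the left is singular and is a nonnegative
  -- multiple of a square.
  have h3 : p * (p + ‖R‖) * (vecNorm x ^ 2 + vecNorm y ^ 2)
      - ((vecNorm x + ‖R‖ * vecNorm y) ^ 2 + (p * vecNorm y) ^ 2)
      = ‖R‖ * ((p + ‖R‖) * (vecNorm x - (p - ‖R‖) * vecNorm y) ^ 2) := by
    linear_combination (vecNorm x ^ 2 + 2 * ‖R‖ * vecNorm x * vecNorm y
      - ‖R‖ * (p - ‖R‖) * vecNorm y ^ 2) * hpR
  have h4 : 0 ≤ ‖R‖ * ((p + ‖R‖) * (vecNorm x - (p - ‖R‖) * vecNorm y) ^ 2) := by positivity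
  linarith

lemma norm_conditionBlock_mul_le {R : Matrix ι κ ℂ} {p : ℝ} (hp : 0 < p)
    (hpR : p ^ 2 = 1 + ‖R‖ ^ 2) :
    ‖(Matrix.fromBlocks 1 (-R) 0 ((p : ℂ) • 1) : Matrix (ι ⊕ κ) (ι ⊕ κ) ℂ)‖ *
    ‖(Matrix.fromBlocks 1 ((p : ℂ)⁻¹ • R) 0 ((p : ℂ)⁻¹ • 1) : Matrix (ι ⊕ κ) (ι ⊕ κ) ℂ)‖
      ≤ p + ‖R‖ := by
  have hr := norm_nonneg R
  refine (mul_le_mul (norm_conditionBlock_inv_le hp hpR) (norm_conditionBlock_le hp hpR)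
    (norm_nonneg _) (Real.sqrt_nonneg _)).trans_eq ?_
  rw [← Real.sqrt_mul (by positivity), Real.sqrt_eq_iff_mul_self_eq (by positivity) (by positivity)]
  field_simp

/-- Lower bound for the condition number of a similarity that straightens an oblique projection. -/
lemma add_norm_le_condition [Nonempty ι] [Nonempty κ] {R : Matrix ι κ ℂ} {p : ℝ}
    (hpR : p ^ 2 = 1 + ‖R‖ ^ 2) (hp : 0 < p) {U : Matrix (ι ⊕ κ) (ι ⊕ κ) ℂ} (hU : IsUnit U)
    (h : U * Matrix.fromBlocks 1 0 0 0 = Matrix.fromBlocks 1 (-R) 0 0 * U) :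
    p + ‖R‖ ≤ ‖U⁻¹‖ * ‖U‖ := by
  have hdet : IsUnit U.det := (Matrix.isUnit_iff_isUnit_det U).1 hU
  have hUU : U * U⁻¹ = 1 := Matrix.mul_nonsing_inv U hdet
  have hUU' : U⁻¹ * U = 1 := Matrix.nonsing_inv_mul U hdet
  -- The test vectors `e` and `f` below vanish for R = 0; in that case the bound is 1 = ‖U⁻¹U‖.
  rcases eq_or_ne R 0 with rfl | hR0
  · have hp1 : p = 1 := by
      rw [norm_zero] at hpR; nlinarith
    rw [norm_zero, add_zero, hp1]
    calc (1 : ℝ) = ‖(1 : Matrix (ι ⊕ κ) (ι ⊕ κ) ℂ)‖ := norm_one.symm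
      _ ≤ _ := by rw [← hUU']; exact norm_mul_le _ _
  have hr : 0 < ‖R‖ := norm_pos_iff.2 hR0
  obtain ⟨y, hy, hRy⟩ := Matrix.exists_vecNorm_mulVec_eq R
  have hinv : Matrix.fromBlocks 1 0 0 0 * U⁻¹ = U⁻¹ * Matrix.fromBlocks 1 (-R) 0 0 := by
    calc Matrix.fromBlocks 1 0 0 0 * U⁻¹ = U⁻¹ * (U * Matrix.fromBlocks 1 0 0 0) * U⁻¹ := by
          rw [← mul_assoc U⁻¹, hUU', one_mul]
      _ = _ := by rw [h, mul_assoc, mul_assoc, hUU, mul_one]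
  set r := ‖R‖ with hrdef
  -- The vectors `e` in the range and `f` in the kernel of P both have length p‖R‖. Their images
  -- under U⁻¹ are orthogonal, so `e + f` and `e - f` have equally long images although their own
  -- lengths have ratio p + ‖R‖.
  set e : ι ⊕ κ → ℂ := Sum.elim ((p : ℂ) • R *ᵥ y) 0 with he
  set f : ι ⊕ κ → ℂ := Sum.elim ((r : ℂ) • R *ᵥ y) ((r : ℂ) • y) with hf
  have hPe : (Matrix.fromBlocks 1 (-R) 0 0 : Matrix (ι ⊕ κ) (ι ⊕ κ) ℂ) *ᵥ e = e := by
    rw [he, Matrix.fromBlocks_mulVec_elim]; simp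
  have hPf : (Matrix.fromBlocks 1 (-R) 0 0 : Matrix (ι ⊕ κ) (ι ⊕ κ) ℂ) *ᵥ f = 0 := by
    rw [hf, Matrix.fromBlocks_mulVec_elim]
    ext (i | i) <;> simp [Matrix.mulVec_smul, Matrix.neg_mulVec]
  obtain ⟨g₁, g₂, hg⟩ : ∃ x y, U⁻¹ *ᵥ e = Sum.elim x y := ⟨_, _, (Sum.elim_comp_inl_inr _).symm⟩
  obtain ⟨h₁, h₂, hh⟩ : ∃ x y, U⁻¹ *ᵥ f = Sum.elim x y := ⟨_, _, (Sum.elim_comp_inl_inr _).symm⟩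
  have hg2 : g₂ = 0 := by
    have := congrArg (· *ᵥ e) hinv
    simp only [← Matrix.mulVec_mulVec] at this
    rw [hPe, hg, Matrix.fromBlocks_mulVec_elim] at this
    ext i
    simpa using (congrFun this (Sum.inr i)).symm
  have hh1 : h₁ = 0 := by
    have := congrArg (· *ᵥ f) hinv
    simp only [← Matrix.mulVec_mulVec] at this
    rw [hPf, hh, Matrix.fromBlocks_mulVec_elim, Matrix.mulVec_zero] at this
    ext i
    simpa using congrFun this (Sum.inl i)
  have heq : vecNorm (U⁻¹ *ᵥ (e + f)) = vecNorm (U⁻¹ *ᵥ (e - f)) := by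
    rw [Matrix.mulVec_add, Matrix.mulVec_sub, hg, hh, hg2, hh1,
      ← sq_eq_sq₀ (vecNorm_nonneg _) (vecNorm_nonneg _)]
    have e1 : Sum.elim g₁ (0 : κ → ℂ) + Sum.elim (0 : ι → ℂ) h₂ = Sum.elim g₁ h₂ := by
      ext (i | i) <;> simp
    have e2 : Sum.elim g₁ (0 : κ → ℂ) - Sum.elim (0 : ι → ℂ) h₂ = Sum.elim g₁ (-h₂) := by
      ext (i | i) <;> simp
    rw [e1, e2, vecNorm_sumElim_sq, vecNorm_sumElim_sq, vecNorm_neg]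
  have hplus : vecNorm (e + f) ^ 2 = ((p + r) * r) ^ 2 + r ^ 2 := by
    have : e + f = Sum.elim (((p + r : ℝ) : ℂ) • R *ᵥ y) ((r : ℂ) • y) := by
      ext (i | i) <;> simp [he, hf, add_mul]
    rw [this, vecNorm_sumElim_sq, vecNorm_smul, vecNorm_smul, hRy, hy, Complex.norm_real,
      Complex.norm_real, mul_pow, Real.norm_eq_abs, sq_abs, mul_pow, Real.norm_eq_abs, sq_abs]
    ring
  have hminus : vecNorm (e - f) ^ 2 = ((p - r) * r) ^ 2 + r ^ 2 := by
    have : e - f = Sum.elim (((p - r : ℝ) : ℂ) • R *ᵥ y) (-((r : ℂ) • y)) := by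
      ext (i | i) <;> simp [he, hf, sub_mul]
    rw [this, vecNorm_sumElim_sq, vecNorm_neg, vecNorm_smul, vecNorm_smul, hRy, hy,
      Complex.norm_real, Complex.norm_real, mul_pow, Real.norm_eq_abs, sq_abs, mul_pow,
      Real.norm_eq_abs, sq_abs]
    ring
  have hratio : vecNorm (e + f) = (p + r) * vecNorm (e - f) := by
    rw [← sq_eq_sq₀ (vecNorm_nonneg _) (mul_nonneg (by positivity) (vecNorm_nonneg _)), mul_pow,
      hplus, hminus]
    linear_combination (-r ^ 2 * (p ^ 2 - r ^ 2 + 1)) * hpR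
  have hpos : 0 < vecNorm (e - f) := by
    refine lt_of_le_of_ne (vecNorm_nonneg _) fun h0 => ?_
    rw [← h0] at hminus
    nlinarith [sq_nonneg ((p - r) * r)]
  refine le_of_mul_le_mul_right ?_ hpos
  rw [← hratio]
  calc vecNorm (e + f) = vecNorm (U *ᵥ (U⁻¹ *ᵥ (e + f))) := by
        rw [Matrix.mulVec_mulVec, hUU, Matrix.one_mulVec]
    _ ≤ ‖U‖ * vecNorm (U⁻¹ *ᵥ (e + f)) := vecNorm_mulVec_le _ _
    _ = ‖U‖ * vecNorm (U⁻¹ *ᵥ (e - f)) := by rw [heq]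
    _ ≤ ‖U‖ * (‖U⁻¹‖ * vecNorm (e - f)) := by gcongr; exact vecNorm_mulVec_le _ _
    _ = _ := by ring

/-- A block-diagonalizing similarity straightens the spectral projection. -/
lemma mul_eq_obliqueProjection_mul_of_conj {A₁₁ : Matrix ι ι ℂ} {A₁₂ R : Matrix ι κ ℂ}
    {A₂₂ : Matrix κ κ ℂ} (hR : A₁₁ * R - R * A₂₂ = -A₁₂)
    (hinj : ∀ X : Matrix κ ι ℂ, A₂₂ * X = X * A₁₁ → X = 0) {U : Matrix (ι ⊕ κ) (ι ⊕ κ) ℂ}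
    (hU : IsUnit U)
    (h : U⁻¹ * Matrix.fromBlocks A₁₁ A₁₂ 0 A₂₂ * U = Matrix.fromBlocks A₁₁ 0 0 A₂₂) :
    U * Matrix.fromBlocks 1 0 0 0 = Matrix.fromBlocks 1 (-R) 0 0 * U := by
  have hA12 : A₁₂ = R * A₂₂ - A₁₁ * R := by rw [← neg_sub, hR, neg_neg]
  have hdet : IsUnit U.det := (Matrix.isUnit_iff_isUnit_det U).1 hU
  have hAU : Matrix.fromBlocks A₁₁ A₁₂ 0 A₂₂ * U = U * Matrix.fromBlocks A₁₁ 0 0 A₂₂ := by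
    rw [← h, ← mul_assoc, ← mul_assoc, Matrix.mul_nonsing_inv U hdet, one_mul]
  rw [← Matrix.fromBlocks_toBlocks U] at hAU ⊢
  set U₁₁ := U.toBlocks₁₁
  set U₁₂ := U.toBlocks₁₂
  set U₂₁ := U.toBlocks₂₁
  set U₂₂ := U.toBlocks₂₂
  simp only [Matrix.fromBlocks_multiply, Matrix.fromBlocks_inj, Matrix.zero_mul, Matrix.mul_zero,
    add_zero, zero_add] at hAU
  -- The lower left block of U intertwines A₂₂ and A₁₁, and U₁₂ − RU₂₂ intertwines A₁₁ and A₂₂; both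
  -- vanish.
  obtain ⟨-, h12, h21, h22⟩ := hAU
  have hU21 : U₂₁ = 0 := hinj _ h21
  have hU12 : U₁₂ - R * U₂₂ = 0 := by
    refine eq_zero_of_mul_eq_mul_swap hinj ?_
    rw [Matrix.mul_sub, Matrix.sub_mul, ← h12, hA12, Matrix.sub_mul, Matrix.mul_assoc R U₂₂, ← h22,
      Matrix.mul_assoc, Matrix.mul_assoc]
    abel
  rw [Matrix.fromBlocks_multiply, Matrix.fromBlocks_multiply]
  simp [hU21, ← sub_eq_add_neg, hU12]

end BlockDiagonalization

/-! ### Algebra and norm bounds for the Riccati equation. -/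

section Riccati

variable {ι κ : Type*} [Fintype ι] [Fintype κ]

/-- The left-hand side of the Riccati equation for the invariant subspace spanned by `[I; X]` of
the matrix `[A₁ + F₁₁, F₁₂; F₂₁, A₂ + F₂₂]`. -/
def riccati (A₁ : Matrix ι ι ℂ) (A₂ : Matrix κ κ ℂ) (F₁₁ : Matrix ι ι ℂ) (F₁₂ : Matrix ι κ ℂ)
    (F₂₁ : Matrix κ ι ℂ) (F₂₂ : Matrix κ κ ℂ) (X : Matrix κ ι ℂ) : Matrix κ ι ℂ :=
  A₂ * X - X * A₁ + (F₂₁ + (F₂₂ * X - X * F₁₁) - X * F₁₂ * X)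

variable {A₁ : Matrix ι ι ℂ} {A₂ : Matrix κ κ ℂ} {F₁₁ : Matrix ι ι ℂ} {F₁₂ : Matrix ι κ ℂ}
  {F₂₁ : Matrix κ ι ℂ} {F₂₂ : Matrix κ κ ℂ} {X : Matrix κ ι ℂ}

/-- This duality exchanges the two diagonal blocks, so statements on N follow from those on M. -/
lemma riccati_conjTranspose :
    riccati A₂ᴴ A₁ᴴ F₂₂ᴴ F₁₂ᴴ F₂₁ᴴ F₁₁ᴴ (-Xᴴ) = (riccati A₁ A₂ F₁₁ F₁₂ F₂₁ F₂₂ X)ᴴ := by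
  simp only [riccati, Matrix.conjTranspose_add, Matrix.conjTranspose_sub,
    Matrix.conjTranspose_mul, Matrix.mul_neg, Matrix.neg_mul, Matrix.mul_assoc]
  abel

/-- Splitting the quadratic term as XF₁₂X − YF₁₂Y = (X − Y)F₁₂X + YF₁₂(X − Y) makes the difference
an exact Sylvester expression, with no remainder. -/
lemma riccati_sub (Y : Matrix κ ι ℂ) :
    riccati A₁ A₂ F₁₁ F₁₂ F₂₁ F₂₂ X - riccati A₁ A₂ F₁₁ F₁₂ F₂₁ F₂₂ Y
      = (A₂ + F₂₂ - Y * F₁₂) * (X - Y) - (X - Y) * (A₁ + F₁₁ + F₁₂ * X) := by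
  simp only [riccati, Matrix.mul_sub, Matrix.sub_mul, Matrix.mul_add, Matrix.add_mul,
    Matrix.mul_assoc]
  abel

variable [DecidableEq ι] [DecidableEq κ]

lemma Matrix.l2_opNorm_fromBlocks_swap_le (A : Matrix ι ι ℂ) (B : Matrix ι κ ℂ)
    (C : Matrix κ ι ℂ) (D : Matrix κ κ ℂ) :
    ‖Matrix.fromBlocks D C B A‖ ≤ ‖Matrix.fromBlocks A B C D‖ := by
  refine Matrix.l2_opNorm_fromBlocks_le (norm_nonneg _) fun x y => ?_
  have h := pow_le_pow_left₀ (vecNorm_nonneg _)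
    (vecNorm_mulVec_le (Matrix.fromBlocks A B C D) (Sum.elim y x)) 2
  rw [mul_pow, Matrix.fromBlocks_mulVec_elim, vecNorm_sumElim_sq, vecNorm_sumElim_sq] at h
  rw [add_comm (D *ᵥ x), add_comm (B *ᵥ x)]
  linarith

/-- The expression is [−X, I] F [I; X], and each outer factor has norm at most √(1 + ‖X‖²). -/
lemma norm_quadratic_le (F₁₁ : Matrix ι ι ℂ) (F₁₂ : Matrix ι κ ℂ)
    (F₂₁ : Matrix κ ι ℂ) (F₂₂ : Matrix κ κ ℂ) (X : Matrix κ ι ℂ) :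
    ‖F₂₁ + (F₂₂ * X - X * F₁₁) - X * F₁₂ * X‖
      ≤ ‖Matrix.fromBlocks F₁₁ F₁₂ F₂₁ F₂₂‖ * (1 + ‖X‖ ^ 2) := by
  refine Matrix.l2_opNorm_le_of_vecNorm (by positivity) fun y => ?_
  set η := ‖Matrix.fromBlocks F₁₁ F₁₂ F₂₁ F₂₂‖
  set g₁ := F₁₁ *ᵥ y + F₁₂ *ᵥ (X *ᵥ y) with hg1
  set g₂ := F₂₁ *ᵥ y + F₂₂ *ᵥ (X *ᵥ y) with hg2
  have heq : (F₂₁ + (F₂₂ * X - X * F₁₁) - X * F₁₂ * X) *ᵥ y = g₂ - X *ᵥ g₁ := by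
    simp only [hg1, hg2, Matrix.add_mulVec, Matrix.sub_mulVec, ← Matrix.mulVec_mulVec,
      Matrix.mulVec_add]
    abel
  have h := pow_le_pow_left₀ (vecNorm_nonneg _)
    (vecNorm_mulVec_le (Matrix.fromBlocks F₁₁ F₁₂ F₂₁ F₂₂) (Sum.elim y (X *ᵥ y))) 2
  rw [mul_pow, Matrix.fromBlocks_mulVec_elim, vecNorm_sumElim_sq, vecNorm_sumElim_sq] at h
  have h1 := pow_le_pow_left₀ (vecNorm_nonneg _) (vecNorm_mulVec_le X y) 2
  have h2 : vecNorm (g₂ - X *ᵥ g₁) ≤ vecNorm g₂ + ‖X‖ * vecNorm g₁ :=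
    (vecNorm_sub_le _ _).trans (by gcongr; exact vecNorm_mulVec_le X g₁)
  have h3 := pow_le_pow_left₀ (vecNorm_nonneg _) h2 2
  have h4 : (vecNorm g₂ + ‖X‖ * vecNorm g₁) ^ 2
      ≤ (1 + ‖X‖ ^ 2) * (vecNorm g₁ ^ 2 + vecNorm g₂ ^ 2) := by
    nlinarith [sq_nonneg (vecNorm g₁ - ‖X‖ * vecNorm g₂)]
  rw [heq, ← sq_le_sq₀ (vecNorm_nonneg _) (mul_nonneg (by positivity) (vecNorm_nonneg y))]
  calc vecNorm (g₂ - X *ᵥ g₁) ^ 2 ≤ (1 + ‖X‖ ^ 2) * (vecNorm g₁ ^ 2 + vecNorm g₂ ^ 2) := h3.trans h4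
    _ ≤ (1 + ‖X‖ ^ 2) * (η ^ 2 * (vecNorm y ^ 2 + (‖X‖ * vecNorm y) ^ 2)) := by
      gcongr
      exact h.trans (by gcongr)
    _ = _ := by ring

lemma isBoundedBilinearMap_mul_mul (C : Matrix ι κ ℂ) :
    IsBoundedBilinearMap ℂ fun z : Matrix κ ι ℂ × Matrix κ ι ℂ => z.1 * C * z.2 where
  add_left x y z := by simp [Matrix.add_mul]
  smul_left c x y := by simp
  add_right x y z := by simp [Matrix.mul_add]
  smul_right c x y := by simp
  bound := ⟨‖C‖ + 1, by positivity, fun x y => by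
    calc ‖x * C * y‖ ≤ ‖x‖ * ‖C‖ * ‖y‖ :=
          (Matrix.l2_opNorm_mul _ _).trans (by gcongr; exact Matrix.l2_opNorm_mul _ _)
      _ ≤ (‖C‖ + 1) * ‖x‖ * ‖y‖ := by
          have := norm_nonneg x
          gcongr ?_ * ‖y‖
          linarith⟩

end Riccati

/-! ### Localization of spectra; uniqueness and existence of small Riccati solutions. -/

section RiccatiSpectrum

variable {m k : ℕ} {A₁ : Matrix (Fin m) (Fin m) ℂ} {A₂ : Matrix (Fin k) (Fin k) ℂ}
  {F₁₁ : Matrix (Fin m) (Fin m) ℂ} {F₁₂ : Matrix (Fin m) (Fin k) ℂ}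
  {F₂₁ : Matrix (Fin k) (Fin m) ℂ} {F₂₂ : Matrix (Fin k) (Fin k) ℂ}
  {X : Matrix (Fin k) (Fin m) ℂ} {η : ℝ}

/-- For an eigenvector u of M, the vector [u; Xu] is an eigenvector of the full perturbed matrix, so
its residual with respect to diag(A₁, A₂) is −F[u; Xu]. -/
lemma spectrum_subset_pseudospectrum_of_riccati
    (hsep : ∀ a b z, z ∈ pseudospectrum a A₁ → z ∈ pseudospectrum b A₂ → 2 * η < a + b)
    (hF : ‖Matrix.fromBlocks F₁₁ F₁₂ F₂₁ F₂₂‖ ≤ η)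
    (hX : riccati A₁ A₂ F₁₁ F₁₂ F₂₁ F₂₂ X = 0) (hX1 : ‖X‖ ≤ 1) :
    spectrum ℂ (A₁ + F₁₁ + F₁₂ * X) ⊆ pseudospectrum η A₁ := by
  intro z hz
  obtain ⟨u, hu, hMu⟩ := Matrix.mem_spectrum_iff_exists_mulVec.1 hz
  have hη : 0 ≤ η := (norm_nonneg _).trans hF
  have hXu : vecNorm (X *ᵥ u) ≤ vecNorm u :=
    (vecNorm_mulVec_le X u).trans (mul_le_of_le_one_left (vecNorm_nonneg u) hX1)
  refine mem_pseudospectrum_of_joint_residual (w := X *ᵥ u) hη hsep hu hXu ?_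
  have h1 : A₁ *ᵥ u - z • u = -(F₁₁ *ᵥ u + F₁₂ *ᵥ (X *ᵥ u)) := by
    rw [← hMu, Matrix.add_mulVec, Matrix.add_mulVec, Matrix.mulVec_mulVec]; abel
  have h2 : A₂ *ᵥ (X *ᵥ u) - z • X *ᵥ u = -(F₂₁ *ᵥ u + F₂₂ *ᵥ (X *ᵥ u)) := by
    have h3 := congrArg (· *ᵥ u) hX
    simp only [riccati, Matrix.add_mulVec, Matrix.sub_mulVec, ← Matrix.mulVec_mulVec,
      Matrix.zero_mulVec] at h3
    rw [← Matrix.mulVec_smul, ← hMu, Matrix.add_mulVec, Matrix.add_mulVec, ← Matrix.mulVec_mulVec,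
      Matrix.mulVec_add, Matrix.mulVec_add, ← sub_eq_zero, ← h3]
    abel
  have h := pow_le_pow_left₀ (vecNorm_nonneg _)
    (vecNorm_mulVec_le (Matrix.fromBlocks F₁₁ F₁₂ F₂₁ F₂₂) (Sum.elim u (X *ᵥ u))) 2
  rw [mul_pow, Matrix.fromBlocks_mulVec_elim, vecNorm_sumElim_sq, vecNorm_sumElim_sq] at h
  rw [h1, h2, vecNorm_neg, vecNorm_neg]
  exact h.trans (by gcongr)

lemma spectrum_subset_pseudospectrum_of_riccati_left
    (hsep : ∀ a b z, z ∈ pseudospectrum a A₂ → z ∈ pseudospectrum b A₁ → 2 * η < a + b)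
    (hF : ‖Matrix.fromBlocks F₁₁ F₁₂ F₂₁ F₂₂‖ ≤ η)
    (hX : riccati A₁ A₂ F₁₁ F₁₂ F₂₁ F₂₂ X = 0) (hX1 : ‖X‖ ≤ 1) :
    spectrum ℂ (A₂ + F₂₂ - X * F₁₂) ⊆ pseudospectrum η A₂ := by
  intro z hz
  have hF' : ‖Matrix.fromBlocks F₂₂ᴴ F₁₂ᴴ F₂₁ᴴ F₁₁ᴴ‖ ≤ η := by
    refine (Matrix.l2_opNorm_fromBlocks_swap_le _ _ _ _).trans ?_
    rwa [← Matrix.fromBlocks_conjTranspose, Matrix.l2_opNorm_conjTranspose]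
  have hsep' : ∀ a b z, z ∈ pseudospectrum a A₂ᴴ → z ∈ pseudospectrum b A₁ᴴ → 2 * η < a + b := by
    intro a b z ha hb
    refine hsep a b (star z) ?_ ?_
    · rw [← conjTranspose_mem_pseudospectrum_iff, star_star]; exact ha
    · rw [← conjTranspose_mem_pseudospectrum_iff, star_star]; exact hb
  have h := spectrum_subset_pseudospectrum_of_riccati hsep' hF' (X := -Xᴴ)
    (by rw [riccati_conjTranspose, hX, Matrix.conjTranspose_zero])
    (by rwa [norm_neg, Matrix.l2_opNorm_conjTranspose])
  have hN : A₂ᴴ + F₂₂ᴴ + F₁₂ᴴ * -Xᴴ = (A₂ + F₂₂ - X * F₁₂)ᴴ := by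
    simp [sub_eq_add_neg]
  rw [hN] at h
  exact conjTranspose_mem_pseudospectrum_iff.1 (h (Matrix.conjTranspose_mem_spectrum_iff.2 hz))

lemma two_mul_lt_of_mem_pseudospectrum (hη : 2 * η < sep A₂ A₁) (a b : ℝ) (z : ℂ)
    (ha : z ∈ pseudospectrum a A₁) (hb : z ∈ pseudospectrum b A₂) : 2 * η < a + b := by
  linarith [sep_le_add_of_mem_pseudospectrum hb ha]

lemma pseudospectrum_disjoint (hη : 2 * η < sep A₂ A₁) :
    Disjoint (pseudospectrum η A₁) (pseudospectrum η A₂) :=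
  Set.disjoint_left.2 fun z h₁ h₂ => by
    linarith [two_mul_lt_of_mem_pseudospectrum hη η η z h₁ h₂]

/-- Allowing two different solutions serves uniqueness; taking Y = X gives invertibility of the
linearized equation. -/
lemma eq_zero_of_riccati_intertwine (hη : 2 * η < sep A₂ A₁)
    (hF : ‖Matrix.fromBlocks F₁₁ F₁₂ F₂₁ F₂₂‖ ≤ η) {Y Z : Matrix (Fin k) (Fin m) ℂ}
    (hX : riccati A₁ A₂ F₁₁ F₁₂ F₂₁ F₂₂ X = 0) (hX1 : ‖X‖ ≤ 1)
    (hY : riccati A₁ A₂ F₁₁ F₁₂ F₂₁ F₂₂ Y = 0) (hY1 : ‖Y‖ ≤ 1)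
    (hZ : (A₂ + F₂₂ - Y * F₁₂) * Z = Z * (A₁ + F₁₁ + F₁₂ * X)) : Z = 0 := by
  have hsep := two_mul_lt_of_mem_pseudospectrum hη
  refine eq_zero_of_disjoint_spectrum (((pseudospectrum_disjoint hη).symm).mono
    (spectrum_subset_pseudospectrum_of_riccati_left (fun a b z ha hb => ?_) hF hY hY1)
    (spectrum_subset_pseudospectrum_of_riccati hsep hF hX hX1)) hZ
  rw [add_comm]
  exact hsep b a z hb ha

/-- Solutions of the Riccati equation in the unit ball are unique. -/
lemma riccati_unique (hη : 2 * η < sep A₂ A₁) (hF : ‖Matrix.fromBlocks F₁₁ F₁₂ F₂₁ F₂₂‖ ≤ η)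
    {Y : Matrix (Fin k) (Fin m) ℂ}
    (hX : riccati A₁ A₂ F₁₁ F₁₂ F₂₁ F₂₂ X = 0) (hX1 : ‖X‖ ≤ 1)
    (hY : riccati A₁ A₂ F₁₁ F₁₂ F₂₁ F₂₂ Y = 0) (hY1 : ‖Y‖ ≤ 1) : X = Y := by
  refine sub_eq_zero.1 (eq_zero_of_riccati_intertwine hη hF hX hX1 hY hY1 ?_)
  rw [← sub_eq_zero, ← riccati_sub, hX, hY, sub_zero]

lemma norm_le_of_riccati (hs : 0 < sep A₂ A₁) (hF : ‖Matrix.fromBlocks F₁₁ F₁₂ F₂₁ F₂₂‖ ≤ η)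
    (hX : riccati A₁ A₂ F₁₁ F₁₂ F₂₁ F₂₂ X = 0) (hX1 : ‖X‖ ≤ 1) :
    ‖X‖ ≤ 2 * η / sep A₂ A₁ := by
  have hη : 0 ≤ η := (norm_nonneg _).trans hF
  have h := sep_mul_norm_le A₂ A₁ X
  rw [eq_neg_of_add_eq_zero_left hX, norm_neg] at h
  have h1 := h.trans (norm_quadratic_le F₁₁ F₁₂ F₂₁ F₂₂ X)
  have h2 : 1 + ‖X‖ ^ 2 ≤ 2 := by nlinarith [norm_nonneg X]
  rw [le_div_iff₀ hs]
  have h3 := mul_le_mul hF h2 (by positivity) hη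
  linarith

/-- For a parameter `t` where the Riccati equation for `tF` has a solution in the open unit ball,
it also has one for all nearby parameters. -/
lemma riccati_eventually_solvable (hη : 2 * η < sep A₂ A₁) {t : ℂ}
    (hF : ‖Matrix.fromBlocks (t • F₁₁) (t • F₁₂) (t • F₂₁) (t • F₂₂)‖ ≤ η)
    (hX : riccati A₁ A₂ (t • F₁₁) (t • F₁₂) (t • F₂₁) (t • F₂₂) X = 0) (hX1 : ‖X‖ < 1) :
    ∀ᶠ τ in nhds t, ∃ Y : Matrix (Fin k) (Fin m) ℂ, ‖Y‖ < 1 ∧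
      riccati A₁ A₂ (τ • F₁₁) (τ • F₁₂) (τ • F₂₁) (τ • F₂₂) Y = 0 := by
  let Q : Matrix (Fin k) (Fin m) ℂ → Matrix (Fin k) (Fin m) ℂ := fun Y =>
    F₂₁ + (F₂₂ * Y - Y * F₁₁) - Y * F₁₂ * Y
  -- Carrying the parameter along as first component turns the implicit function problem into local
  -- openness of `H`, for which a surjective strict derivative suffices.
  let H : ℂ × Matrix (Fin k) (Fin m) ℂ → ℂ × Matrix (Fin k) (Fin m) ℂ := fun z =>
    (z.1, sylvesterMap A₂ A₁ z.2 + z.1 • Q z.2)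
  have hric : ∀ (τ : ℂ) (Y : Matrix (Fin k) (Fin m) ℂ),
      riccati A₁ A₂ (τ • F₁₁) (τ • F₁₂) (τ • F₂₁) (τ • F₂₂) Y = (H (τ, Y)).2 := fun τ Y => by
    simp [H, Q, riccati, smul_add, smul_sub]
  let L : Matrix (Fin k) (Fin m) ℂ →L[ℂ]
      Matrix (Fin k) (Fin m) ℂ := LinearMap.toContinuousLinearMap (sylvesterMap A₂ A₁)
  let L' : Matrix (Fin k) (Fin m) ℂ →L[ℂ]
      Matrix (Fin k) (Fin m) ℂ := LinearMap.toContinuousLinearMap (sylvesterMap F₂₂ F₁₁)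
  have hB := isBoundedBilinearMap_mul_mul F₁₂
  have hsnd : HasStrictFDerivAt (fun z : ℂ × Matrix (Fin k) (Fin m) ℂ => z.2)
      (ContinuousLinearMap.snd ℂ ℂ _) (t, X) :=
    hasStrictFDerivAt_snd
  have hfst : HasStrictFDerivAt (fun z : ℂ × Matrix (Fin k) (Fin m) ℂ => z.1)
      (ContinuousLinearMap.fst ℂ ℂ _) (t, X) :=
    hasStrictFDerivAt_fst
  have hBd := (hB.hasStrictFDerivAt (X, X)).comp (t, X) (hsnd.prodMk hsnd)
  have hQ := (((L'.hasStrictFDerivAt (x := X)).comp (t, X) hsnd).const_add F₂₁).sub hBd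
  have hH := hfst.prodMk (((L.hasStrictFDerivAt (x := X)).comp (t, X) hsnd).add (hfst.smul hQ))
  have hHd : HasStrictFDerivAt H _ (t, X) := hH
  have hmap := hHd.map_nhds_eq_of_surj (by
    rw [LinearMap.range_eq_top]
    rintro ⟨τ, C⟩
    have hinj : ∀ Z : Matrix (Fin k) (Fin m) ℂ, (A₂ + t • F₂₂ - X * (t • F₁₂)) * Z
        = Z * (A₁ + t • F₁₁ + (t • F₁₂) * X) → Z = 0 := fun Z hZ =>
      eq_zero_of_riccati_intertwine hη hF hX hX1.le hX hX1.le hZ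
    obtain ⟨Z, hZ⟩ := (sylvesterMap_bijective_of_injective hinj).2 (C - τ • Q X)
    refine ⟨(τ, Z), Prod.ext rfl ?_⟩
    rw [sylvesterMap_apply, eq_sub_iff_add_eq] at hZ
    rw [← hZ]
    simp [L, L', Q, sylvesterMap_apply, Matrix.mul_assoc, Matrix.add_mul, Matrix.sub_mul,
      Matrix.mul_add, smul_sub, smul_add]
    abel)
  have hH0 : H (t, X) = (t, 0) := Prod.ext rfl (by rw [← hric, hX])
  have hnhds : {z : ℂ × Matrix (Fin k) (Fin m) ℂ | ‖z.2‖ < 1} ∈ nhds (t, X) :=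
    (isOpen_lt (by fun_prop) continuous_const).mem_nhds hX1
  have himg := Filter.image_mem_map (m := H) hnhds
  rw [hmap, hH0] at himg
  have hcont : Filter.Tendsto (fun τ : ℂ => (τ, (0 : Matrix (Fin k) (Fin m) ℂ))) (nhds t)
      (nhds (t, 0)) :=
    (Continuous.prodMk continuous_id continuous_const).tendsto t
  filter_upwards [hcont himg] with τ hτ
  obtain ⟨⟨τ', Y⟩, hY, hYτ⟩ := hτ
  obtain rfl : τ' = τ := congrArg Prod.fst hYτ
  exact ⟨Y, hY, by rw [hric, hYτ]⟩

/-- Existence of a small solution of the Riccati equation, by continuation. -/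
lemma riccati_exists (hη : 2 * η < sep A₂ A₁)
    (hF : ‖Matrix.fromBlocks F₁₁ F₁₂ F₂₁ F₂₂‖ ≤ η) :
    ∃ X, riccati A₁ A₂ F₁₁ F₁₂ F₂₁ F₂₂ X = 0 ∧ ‖X‖ ≤ 2 * η / sep A₂ A₁ := by
  have hη0 : 0 ≤ η := (norm_nonneg _).trans hF
  have hs : 0 < sep A₂ A₁ := by linarith
  set q := 2 * η / sep A₂ A₁ with hq
  have hq1 : q < 1 := (div_lt_one hs).2 hη
  let ric : ℝ × Matrix (Fin k) (Fin m) ℂ → Matrix (Fin k) (Fin m) ℂ := fun z =>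
    riccati A₁ A₂ ((z.1 : ℂ) • F₁₁) ((z.1 : ℂ) • F₁₂) ((z.1 : ℂ) • F₂₁) ((z.1 : ℂ) • F₂₂) z.2
  have hric : Continuous ric := by
    simp only [ric, riccati]
    fun_prop
  let s : Set ℝ := {t | ∃ X, ‖X‖ ≤ q ∧ ric (t, X) = 0}
  have hFt : ∀ t ∈ Set.Icc (0 : ℝ) 1, ‖Matrix.fromBlocks ((t : ℂ) • F₁₁) ((t : ℂ) • F₁₂)
      ((t : ℂ) • F₂₁) ((t : ℂ) • F₂₂)‖ ≤ η := fun t ht => by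
    rw [← Matrix.fromBlocks_smul, norm_smul, Complex.norm_real, Real.norm_of_nonneg ht.1]
    exact (mul_le_of_le_one_left (norm_nonneg _) ht.2).trans hF
  -- The solvable parameters are the projection of a compact set of pairs (t, X).
  have hclosed : IsClosed (s ∩ Set.Icc 0 1) := by
    have : ProperSpace (Matrix (Fin k) (Fin m) ℂ) := FiniteDimensional.proper ℂ _
    have hcomp : IsCompact ((Set.Icc (0 : ℝ) 1 ×ˢ
        Metric.closedBall (0 : Matrix (Fin k) (Fin m) ℂ) q) ∩ {z | ric z = 0}) :=
      (isCompact_Icc.prod (isCompact_closedBall _ _)).inter_right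
        (isClosed_eq hric continuous_const)
    convert! (hcomp.image continuous_fst).isClosed using 1
    ext t
    constructor
    · rintro ⟨⟨X, hXq, hX⟩, ht⟩
      exact ⟨(t, X), ⟨⟨ht, by simpa using hXq⟩, hX⟩, rfl⟩
    · rintro ⟨⟨t, X⟩, ⟨⟨ht, hXq⟩, hX⟩, rfl⟩
      exact ⟨⟨X, by simpa using hXq, hX⟩, ht⟩
  have h0 : (0 : ℝ) ∈ s := ⟨0, by rw [norm_zero]; positivity, by simp [ric, riccati]⟩
  have hsub := hclosed.Icc_subset_of_forall_exists_gt h0 fun t ht y hy => by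
    obtain ⟨⟨X, hXq, hX⟩, ht⟩ := ht
    have hev := riccati_eventually_solvable hη (hFt t ⟨ht.1, ht.2.le⟩) hX (hXq.trans_lt hq1)
    have hev' : ∀ᶠ τ : ℝ in nhdsWithin t (Set.Ioi t), ∃ Y, ‖Y‖ < 1 ∧ ric (τ, Y) = 0 :=
      (Complex.continuous_ofReal.continuousAt.eventually hev).filter_mono nhdsWithin_le_nhds
    have hmem : Set.Ioc t (min y 1) ∈ nhdsWithin t (Set.Ioi t) :=
      Ioc_mem_nhdsGT (lt_min hy ht.2)
    obtain ⟨τ, ⟨Y, hY1, hY⟩, hτ⟩ := (hev'.and hmem).exists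
    have hτ1 : τ ∈ Set.Icc (0 : ℝ) 1 := ⟨ht.1.trans hτ.1.le, hτ.2.trans (min_le_right _ _)⟩
    -- Local continuation only yields ‖Y‖ < 1; the a priori bound improves this to ‖Y‖ ≤ q.
    exact ⟨τ, ⟨Y, norm_le_of_riccati hs (hFt τ hτ1) hY hY1.le, hY⟩, hτ.1,
      hτ.2.trans (min_le_left _ _)⟩
  obtain ⟨X, hXq, hX⟩ := hsub (Set.right_mem_Icc.2 zero_le_one)
  exact ⟨X, by simpa [ric] using hX, hXq⟩

end RiccatiSpectrum

/-! ### Canonical angles between column spaces. -/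

section Angle

/-- If every unit vector `u` of `U` has some `u + y ∈ V` with `y ⟂ u` and `‖y‖ ≤ τ`, then the
largest canonical angle has tangent at most `τ`. -/
lemma tan_maxAngle_le {ι : Type*} [Fintype ι] {U V : Submodule ℂ (EuclideanSpace ℂ ι)} {τ : ℝ}
    (hτ : 0 ≤ τ)
    (h : ∀ u ∈ U, ‖u‖ = 1 → ∃ y, u + y ∈ V ∧ ‖y‖ ≤ τ ∧ inner ℂ u y = 0) :
    maxAngle U V < Real.pi / 2 ∧ Real.tan (maxAngle U V) ≤ τ := by
  have hpos : (0 : ℝ) < 1 + τ ^ 2 := by positivity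
  have hle : sSup {r : ℝ | ∃ u ∈ U, ‖u‖ = 1 ∧ r = ‖u - V.starProjection u‖}
      ≤ τ / √(1 + τ ^ 2) := by
    refine Real.sSup_le ?_ (by positivity)
    rintro _ ⟨u, huU, hu1, rfl⟩
    obtain ⟨y, hyV, hy, huy⟩ := h u huU hu1
    -- When ‖y‖ = τ, this is the scalar for which c(u + y) is closest to u.
    set c : ℝ := (1 + τ ^ 2)⁻¹ with hc
    have hmin : ‖u - V.starProjection u‖ ≤ ‖u - (c : ℂ) • (u + y)‖ := by
      rw [Submodule.starProjection_minimal]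
      exact ciInf_le ⟨0, by rintro _ ⟨v, rfl⟩; exact norm_nonneg _⟩
        (⟨(c : ℂ) • (u + y), V.smul_mem _ hyV⟩ : V)
    refine hmin.trans ?_
    rw [← sq_le_sq₀ (norm_nonneg _) (by positivity), div_pow, Real.sq_sqrt hpos.le]
    have hdec : u - (c : ℂ) • (u + y) = ((1 - c : ℝ) : ℂ) • u + ((-c : ℝ) : ℂ) • y := by
      push_cast; module
    have hort : inner ℂ (((1 - c : ℝ) : ℂ) • u) (((-c : ℝ) : ℂ) • y) = 0 := by
      rw [inner_smul_left, inner_smul_right, huy]; simp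
    rw [hdec, pow_two, norm_add_sq_eq_norm_sq_add_norm_sq_of_inner_eq_zero _ _ hort, norm_smul,
      norm_smul, hu1, Complex.norm_real, Complex.norm_real]
    have h1 : ‖(1 - c : ℝ)‖ * 1 * (‖(1 - c : ℝ)‖ * 1) = (1 - c) ^ 2 := by
      rw [mul_one, Real.norm_eq_abs, ← pow_two, sq_abs]
    have h2 : ‖-c‖ * ‖y‖ * (‖-c‖ * ‖y‖) = c ^ 2 * ‖y‖ ^ 2 := by
      rw [← pow_two, mul_pow, Real.norm_eq_abs, sq_abs, neg_sq]
    have h3 : c ^ 2 * ‖y‖ ^ 2 ≤ c ^ 2 * τ ^ 2 := by gcongr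
    have h4 : (1 - c) ^ 2 + c ^ 2 * τ ^ 2 = τ ^ 2 / (1 + τ ^ 2) := by
      rw [hc]; field_simp; ring
    linarith
  have hangle : maxAngle U V ≤ Real.arctan τ := by
    rw [Real.arctan_eq_arcsin]
    exact Real.monotone_arcsin hle
  have hlt := hangle.trans_lt (Real.arctan_lt_pi_div_two τ)
  refine ⟨hlt, ?_⟩
  have hgt : -(Real.pi / 2) < maxAngle U V := by
    have : 0 ≤ maxAngle U V := Real.arcsin_nonneg.2 <| Real.sSup_nonneg <| by
      rintro _ ⟨u, -, -, rfl⟩; exact norm_nonneg _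
    linarith [Real.pi_pos]
  rw [← Real.tan_arctan τ]
  exact Real.strictMonoOn_tan.monotoneOn ⟨hgt, hlt⟩
    ⟨Real.neg_pi_div_two_lt_arctan τ, Real.arctan_lt_pi_div_two τ⟩ hangle

variable {ι κ : Type*} [Fintype ι] [Fintype κ] [DecidableEq ι] [DecidableEq κ]

lemma mem_colSpan {B : Matrix ι κ ℂ} {u : EuclideanSpace ℂ ι} :
    u ∈ colSpan B ↔ ∃ x, WithLp.toLp 2 (B *ᵥ x) = u :=
  ⟨fun ⟨x, hx⟩ => ⟨x.ofLp, hx⟩, fun ⟨x, hx⟩ => ⟨WithLp.toLp 2 x, hx⟩⟩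

lemma isInvariantSubspace_colSpan {A : Matrix ι ι ℂ} {B : Matrix ι κ ℂ} {M : Matrix κ κ ℂ}
    (h : A * B = B * M) : IsInvariantSubspace A (colSpan B) := by
  rintro _ ⟨u, hu, rfl⟩
  obtain ⟨x, rfl⟩ := mem_colSpan.1 hu
  refine mem_colSpan.2 ⟨M *ᵥ x, ?_⟩
  rw [Matrix.mulVec_mulVec, ← h, ← Matrix.mulVec_mulVec]
  rfl

omit [DecidableEq κ] in
lemma Matrix.exists_mulVec_eq_of_bounded_below {G : Matrix κ κ ℂ} {c : ℝ} (hc : 0 < c)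
    (hG : ∀ w, c * vecNorm w ≤ vecNorm (G *ᵥ w)) (x : κ → ℂ) : ∃ w, G *ᵥ w = x := by
  have hinj : Function.Injective G.mulVecLin := by
    rw [injective_iff_map_eq_zero]
    intro w hw
    have h := hG w
    rw [show G *ᵥ w = 0 from hw, vecNorm_zero] at h
    exact vecNorm_eq_zero.1 (le_antisymm (nonpos_of_mul_nonpos_right h hc) (vecNorm_nonneg w))
  exact LinearMap.injective_iff_surjective.1 hinj x

/-- The angle between the column spaces of a matrix `B₀` with orthonormal columns and of
`B₀ G + H` with `H` orthogonal to `B₀`. -/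
lemma tan_maxAngle_colSpan_le {B₀ H : Matrix ι κ ℂ} {G : Matrix κ κ ℂ} {c τ : ℝ}
    (hB : B₀ᴴ * B₀ = 1) (hH : B₀ᴴ * H = 0) (hc : 0 < c) (hτ : 0 ≤ τ)
    (hG : ∀ w, c * vecNorm w ≤ vecNorm (G *ᵥ w)) (hHτ : ‖H‖ ≤ τ * c) :
    maxAngle (colSpan B₀) (colSpan (B₀ * G + H)) < Real.pi / 2 ∧
      Real.tan (maxAngle (colSpan B₀) (colSpan (B₀ * G + H))) ≤ τ := by
  refine tan_maxAngle_le hτ fun u hu hu1 => ?_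
  obtain ⟨x, rfl⟩ := mem_colSpan.1 hu
  have hadj : ∀ z : ι → ℂ, star (B₀ *ᵥ x) ⬝ᵥ z = star x ⬝ᵥ B₀ᴴ *ᵥ z := fun z => by
    rw [Matrix.star_mulVec, Matrix.dotProduct_mulVec]
  have hx1 : vecNorm x = 1 := by
    have h1 : vecNorm (B₀ *ᵥ x) = 1 := hu1
    have h2 := hadj (B₀ *ᵥ x)
    rw [Matrix.mulVec_mulVec, hB, Matrix.one_mulVec, star_dotProduct_self, star_dotProduct_self,
      h1] at h2
    have h3 : (1 : ℝ) ^ 2 = vecNorm x ^ 2 := by exact_mod_cast h2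
    exact ((sq_eq_sq₀ zero_le_one (vecNorm_nonneg x)).1 h3).symm
  -- With Gw = x, the vector (B₀G + H)w equals u + Hw, and Hw is orthogonal to u.
  obtain ⟨w, hw⟩ := Matrix.exists_mulVec_eq_of_bounded_below hc hG x
  refine ⟨WithLp.toLp 2 (H *ᵥ w), mem_colSpan.2 ⟨w, ?_⟩, ?_, ?_⟩
  · rw [Matrix.add_mulVec, ← Matrix.mulVec_mulVec, hw, WithLp.toLp_add]
  · have h1 := hG w
    rw [hw, hx1] at h1
    calc vecNorm (H *ᵥ w) ≤ τ * c * vecNorm w :=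
          (vecNorm_mulVec_le H w).trans (mul_le_mul_of_nonneg_right hHτ (vecNorm_nonneg w))
      _ = τ * (c * vecNorm w) := by ring
      _ ≤ τ * 1 := by gcongr
      _ = τ := mul_one τ
  · rw [EuclideanSpace.inner_toLp_toLp, dotProduct_comm, hadj, Matrix.mulVec_mulVec, hH,
      Matrix.zero_mulVec, dotProduct_zero]

omit [DecidableEq ι] in
lemma Matrix.rank_eq_card_of_left_inverse {B : Matrix ι κ ℂ} {C : Matrix κ ι ℂ} (h : C * B = 1) :
    B.rank = Fintype.card κ := by
  apply le_antisymm (Matrix.rank_le_card_width B)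
  rw [← Matrix.rank_one (R := ℂ) (n := κ), ← h]
  exact Matrix.rank_mul_le_right C B

omit [DecidableEq ι] [DecidableEq κ] in
lemma Matrix.l2_opNorm_fromRows_zero_left_le {σ : Type*} [Fintype σ] (X : Matrix κ σ ℂ)
    [DecidableEq σ] : ‖Matrix.fromRows (0 : Matrix ι σ ℂ) X‖ ≤ ‖X‖ := by
  refine Matrix.l2_opNorm_le_of_vecNorm (norm_nonneg _) fun w => ?_
  have : Matrix.fromRows (0 : Matrix ι σ ℂ) X *ᵥ w = Sum.elim (0 : ι → ℂ) (X *ᵥ w) := by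
    rw [Matrix.fromRows_mulVec, Matrix.zero_mulVec]
  rw [this, vecNorm_sumElim_zero_left]
  exact vecNorm_mulVec_le X w

omit [DecidableEq ι] [DecidableEq κ] in
lemma Matrix.l2_opNorm_fromRows_zero_right_le {σ : Type*} [Fintype σ] (X : Matrix ι σ ℂ)
    [DecidableEq σ] : ‖Matrix.fromRows X (0 : Matrix κ σ ℂ)‖ ≤ ‖X‖ := by
  refine Matrix.l2_opNorm_le_of_vecNorm (norm_nonneg _) fun w => ?_
  have : Matrix.fromRows X (0 : Matrix κ σ ℂ) *ᵥ w = Sum.elim (X *ᵥ w) (0 : κ → ℂ) := by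
    rw [Matrix.fromRows_mulVec, Matrix.zero_mulVec]
  rw [this, vecNorm_sumElim_zero_right]
  exact vecNorm_mulVec_le X w

/-- A small perturbation of a scalar matrix is bounded below. -/
lemma mul_vecNorm_le_vecNorm_smul_one_add {c : ℝ} (hc : 0 ≤ c) (Z : Matrix κ κ ℂ) (w : κ → ℂ) :
    (c - ‖Z‖) * vecNorm w ≤ vecNorm (((c : ℂ) • (1 : Matrix κ κ ℂ) + Z) *ᵥ w) := by
  have h1 : (c : ℂ) • w = ((c : ℂ) • (1 : Matrix κ κ ℂ) + Z) *ᵥ w - Z *ᵥ w := by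
    rw [Matrix.add_mulVec, Matrix.smul_mulVec, Matrix.one_mulVec, add_sub_cancel_right]
  have h2 : c * vecNorm w = vecNorm ((c : ℂ) • w) := by
    rw [vecNorm_smul, Complex.norm_real, Real.norm_of_nonneg hc]
  have h3 := vecNorm_sub_le (((c : ℂ) • (1 : Matrix κ κ ℂ) + Z) *ᵥ w) (Z *ᵥ w)
  rw [← h1, ← h2] at h3
  linarith [vecNorm_mulVec_le Z w]

end Angle

/-! ### Conjugated perturbation, invariant pairs and angle bounds. -/

section Perturbation

variable {ι κ : Type*} [Fintype ι] [Fintype κ] [DecidableEq ι] [DecidableEq κ]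

lemma Matrix.inv_fromBlocks_one_zero_one (X : Matrix κ ι ℂ) :
    (Matrix.fromBlocks 1 0 X 1 : Matrix (ι ⊕ κ) (ι ⊕ κ) ℂ)⁻¹ = Matrix.fromBlocks 1 0 (-X) 1 :=
  Matrix.inv_eq_left_inv (by simp [Matrix.fromBlocks_multiply, Matrix.fromBlocks_one])

/-- Conjugation of the perturbation by the block-diagonalizing similarity. -/
lemma conditionBlock_conj_perturbation (R : Matrix ι κ ℂ) {p : ℂ} (hp : p ≠ 0)
    (E₁₁ : Matrix ι ι ℂ) (E₁₂ : Matrix ι κ ℂ) (E₂₁ : Matrix κ ι ℂ) (E₂₂ : Matrix κ κ ℂ) :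
    (Matrix.fromBlocks 1 (-R) 0 (p • 1) : Matrix (ι ⊕ κ) (ι ⊕ κ) ℂ)
      * Matrix.fromBlocks E₁₁ E₁₂ E₂₁ E₂₂ * Matrix.fromBlocks 1 (p⁻¹ • R) 0 (p⁻¹ • 1)
      = Matrix.fromBlocks (E₁₁ - R * E₂₁) (p⁻¹ • (E₁₁ * R + E₁₂ - R * (E₂₁ * R + E₂₂)))
        (p • E₂₁) (E₂₁ * R + E₂₂) := by
  rw [Matrix.fromBlocks_multiply, Matrix.fromBlocks_multiply, Matrix.fromBlocks_inj]
  refine ⟨?_, ?_, ?_, ?_⟩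
  · simp [sub_eq_add_neg]
  · simp only [Matrix.one_mul, Matrix.neg_mul, Matrix.mul_smul, Matrix.mul_one, Matrix.mul_add,
      Matrix.add_mul, Matrix.mul_assoc, smul_add, smul_sub, smul_neg]
    abel
  · simp
  · simp [smul_smul, hp]

/-- Three of the four blocks agree for every X; only the lower left one imposes a condition. -/
lemma blockLower_conj_eq_iff_riccati {A₁ F₁₁ : Matrix ι ι ℂ} {A₂ F₂₂ : Matrix κ κ ℂ}
    {F₁₂ : Matrix ι κ ℂ} {F₂₁ X : Matrix κ ι ℂ} :
    Matrix.fromBlocks 1 0 (-X) 1 * Matrix.fromBlocks (A₁ + F₁₁) F₁₂ F₂₁ (A₂ + F₂₂)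
        * Matrix.fromBlocks 1 0 X 1
      = Matrix.fromBlocks (A₁ + F₁₁ + F₁₂ * X) F₁₂ 0 (A₂ + F₂₂ - X * F₁₂) ↔
    riccati A₁ A₂ F₁₁ F₁₂ F₂₁ F₂₂ X = 0 := by
  have h21 : -X * (A₁ + F₁₁) + F₂₁ + (-X * F₁₂ + (A₂ + F₂₂)) * X
      = riccati A₁ A₂ F₁₁ F₁₂ F₂₁ F₂₂ X := by
    simp only [riccati, Matrix.neg_mul, Matrix.add_mul, Matrix.mul_add]
    abel
  have h22 : -(X * F₁₂) + (A₂ + F₂₂) = A₂ + F₂₂ - X * F₁₂ := by abel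
  rw [Matrix.fromBlocks_multiply, Matrix.fromBlocks_multiply, Matrix.fromBlocks_inj]
  simp only [Matrix.one_mul, Matrix.mul_one, Matrix.zero_mul, Matrix.mul_zero, add_zero, zero_add,
    h21, true_and, and_iff_left_iff_imp]
  intro _
  rw [Matrix.neg_mul, h22]

omit [DecidableEq κ] in
lemma blocks_mul_fromRows_of_riccati {A₁ F₁₁ : Matrix ι ι ℂ} {A₂ F₂₂ : Matrix κ κ ℂ}
    {F₁₂ : Matrix ι κ ℂ} {F₂₁ X : Matrix κ ι ℂ} (h : riccati A₁ A₂ F₁₁ F₁₂ F₂₁ F₂₂ X = 0) :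
    Matrix.fromBlocks (A₁ + F₁₁) F₁₂ F₂₁ (A₂ + F₂₂) * Matrix.fromRows (1 : Matrix ι ι ℂ) X
      = Matrix.fromRows (1 : Matrix ι ι ℂ) X * (A₁ + F₁₁ + F₁₂ * X) := by
  rw [Matrix.fromBlocks_mul_fromRows, Matrix.fromRows_mul, Matrix.mul_one, Matrix.mul_one,
    Matrix.one_mul]
  congr 1
  rw [← sub_eq_zero, ← h]
  simp only [riccati, Matrix.add_mul, Matrix.mul_add, Matrix.mul_assoc]
  abel

omit [DecidableEq ι] in
lemma fromCols_mul_blocks_of_riccati {A₁ F₁₁ : Matrix ι ι ℂ} {A₂ F₂₂ : Matrix κ κ ℂ}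
    {F₁₂ : Matrix ι κ ℂ} {F₂₁ X : Matrix κ ι ℂ} (h : riccati A₁ A₂ F₁₁ F₁₂ F₂₁ F₂₂ X = 0) :
    (Matrix.fromRows (-Xᴴ) (1 : Matrix κ κ ℂ))ᴴ * Matrix.fromBlocks (A₁ + F₁₁) F₁₂ F₂₁ (A₂ + F₂₂)
      = (A₂ + F₂₂ - X * F₁₂) * (Matrix.fromRows (-Xᴴ) (1 : Matrix κ κ ℂ))ᴴ := by
  rw [Matrix.conjTranspose_fromRows_eq_fromCols_conjTranspose, Matrix.conjTranspose_neg,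
    Matrix.conjTranspose_conjTranspose, Matrix.conjTranspose_one, Matrix.fromCols_mul_fromBlocks,
    Matrix.mul_fromCols, Matrix.one_mul, Matrix.one_mul, Matrix.mul_one]
  congr 1
  · rw [← sub_eq_zero, ← h]
    simp only [riccati, Matrix.add_mul, Matrix.sub_mul, Matrix.mul_add, Matrix.mul_neg,
      Matrix.neg_mul]
    abel
  · rw [Matrix.neg_mul]; abel

lemma isRightInvariantPair_of_conj {B S T W : Matrix (ι ⊕ κ) (ι ⊕ κ) ℂ} (hST : S * T = 1)
    (hTS : T * S = 1) (hW : T * B * S = W) {X : Matrix κ ι ℂ} {M : Matrix ι ι ℂ}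
    (h : W * Matrix.fromRows (1 : Matrix ι ι ℂ) X = Matrix.fromRows (1 : Matrix ι ι ℂ) X * M) :
    IsRightInvariantPair B (S * Matrix.fromRows (1 : Matrix ι ι ℂ) X) M := by
  refine ⟨Matrix.rank_eq_card_of_left_inverse
    (C := Matrix.fromCols (1 : Matrix ι ι ℂ) (0 : Matrix ι κ ℂ) * T) ?_, ?_⟩
  · rw [Matrix.mul_assoc, ← Matrix.mul_assoc T, hTS, Matrix.one_mul, Matrix.fromCols_mul_fromRows]
    simp
  · have hBS : B * S = S * W := by
      rw [← hW, ← mul_assoc, ← mul_assoc, hST, one_mul]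
    rw [← Matrix.mul_assoc, hBS, Matrix.mul_assoc, h, Matrix.mul_assoc]

lemma isLeftInvariantPair_of_conj {B S T W : Matrix (ι ⊕ κ) (ι ⊕ κ) ℂ} (hST : S * T = 1)
    (hTS : T * S = 1) (hW : T * B * S = W) {X : Matrix ι κ ℂ} {N : Matrix κ κ ℂ}
    (h : (Matrix.fromRows X (1 : Matrix κ κ ℂ))ᴴ * W
      = N * (Matrix.fromRows X (1 : Matrix κ κ ℂ))ᴴ) :
    IsLeftInvariantPair B (Tᴴ * Matrix.fromRows X (1 : Matrix κ κ ℂ)) N := by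
  refine ⟨Matrix.rank_eq_card_of_left_inverse
    (C := Matrix.fromCols (0 : Matrix κ ι ℂ) (1 : Matrix κ κ ℂ) * Sᴴ) ?_, ?_⟩
  · rw [Matrix.mul_assoc, ← Matrix.mul_assoc Sᴴ, ← Matrix.conjTranspose_mul, hTS,
      Matrix.conjTranspose_one, Matrix.one_mul, Matrix.fromCols_mul_fromRows]
    simp
  · have hTB : T * B = W * T := by
      rw [← hW, mul_assoc, hST, mul_one]
    rw [Matrix.conjTranspose_mul, Matrix.conjTranspose_conjTranspose, Matrix.mul_assoc, hTB,
      ← Matrix.mul_assoc, h, Matrix.mul_assoc]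

lemma IsLeftInvariantPair.conjTranspose_mul_eq {ι κ : Type*} [Fintype ι] [Fintype κ]
    {B : Matrix ι ι ℂ} {Y : Matrix ι κ ℂ} {N : Matrix κ κ ℂ} (h : IsLeftInvariantPair B Y N) :
    Bᴴ * Y = Y * Nᴴ := by
  have := congrArg Matrix.conjTranspose h.2
  simpa using this

/-- From (p + r)(p − r) = 1 and q ≤ 1 one gets (p + r)(p − rq) ≥ 1. This turns the tangent bound
q/(p − rq) into (p + r)q. -/
lemma le_mul_sub_of_sq_eq {p r q : ℝ} (hpr : p ^ 2 = 1 + r ^ 2) (hr : 0 ≤ r) (hp : 0 < p)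
    (hq : 0 ≤ q) (hq1 : q ≤ 1) : q ≤ (p + r) * q * (p - r * q) := by
  have h1 : r * q ≤ r := mul_le_of_le_one_right hr hq1
  have h2 : 1 ≤ (p + r) * (p - r * q) := by nlinarith
  nlinarith

lemma Matrix.fromRows_add_fromRows {m₁ m₂ n R : Type*} [Add R] (A₁ B₁ : Matrix m₁ n R)
    (A₂ B₂ : Matrix m₂ n R) : Matrix.fromRows A₁ A₂ + Matrix.fromRows B₁ B₂
      = Matrix.fromRows (A₁ + B₁) (A₂ + B₂) := by
  ext (i | i) j <;> rfl

/-- The basis of the perturbed subspace is [I + RX/p; X/p], whose upper block is bounded below by 1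
− ‖R‖q/p. -/
lemma tan_maxAngle_right_le {R : Matrix ι κ ℂ} {X : Matrix κ ι ℂ} {p q : ℝ} (hp : 0 < p)
    (hpR : p ^ 2 = 1 + ‖R‖ ^ 2) (hX : ‖X‖ ≤ q) (hq1 : q ≤ 1) :
    let U := colSpan (Matrix.fromRows (1 : Matrix ι ι ℂ) (0 : Matrix κ ι ℂ))
    let V := colSpan ((Matrix.fromBlocks 1 ((p : ℂ)⁻¹ • R) 0 ((p : ℂ)⁻¹ • 1) :
      Matrix (ι ⊕ κ) (ι ⊕ κ) ℂ) * Matrix.fromRows (1 : Matrix ι ι ℂ) X)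
    maxAngle U V < Real.pi / 2 ∧ Real.tan (maxAngle U V) ≤ (p + ‖R‖) * q := by
  intro U V
  have hr := norm_nonneg R
  have hq : 0 ≤ q := (norm_nonneg X).trans hX
  have hpr : ‖R‖ < p := lt_of_pow_lt_pow_left₀ 2 hp.le (by linarith)
  have hinv : ‖(p : ℂ)⁻¹‖ = p⁻¹ := by
    rw [norm_inv, Complex.norm_real, Real.norm_of_nonneg hp.le]
  have hV : V = colSpan (Matrix.fromRows (1 : Matrix ι ι ℂ) (0 : Matrix κ ι ℂ) *
      (((1 : ℝ) : ℂ) • (1 : Matrix ι ι ℂ) + (p : ℂ)⁻¹ • (R * X))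
      + Matrix.fromRows (0 : Matrix ι ι ℂ) ((p : ℂ)⁻¹ • X)) := by
    simp only [V]
    congr 1
    rw [Matrix.fromBlocks_mul_fromRows, Matrix.fromRows_mul, Matrix.fromRows_add_fromRows]
    simp
  have hRX : ‖(p : ℂ)⁻¹ • (R * X)‖ ≤ ‖R‖ * q / p := by
    rw [norm_smul, hinv, inv_mul_eq_div]
    gcongr
    exact (Matrix.l2_opNorm_mul R X).trans (by gcongr)
  have hc : 0 < 1 - ‖R‖ * q / p := by
    rw [sub_pos, div_lt_one hp]
    exact (mul_le_of_le_one_right hr hq1).trans_lt hpr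
  rw [hV]
  refine tan_maxAngle_colSpan_le (c := 1 - ‖R‖ * q / p) ?_ ?_ hc (by positivity) (fun w => ?_) ?_
  · rw [Matrix.conjTranspose_fromRows_eq_fromCols_conjTranspose, Matrix.fromCols_mul_fromRows]
    simp
  · rw [Matrix.conjTranspose_fromRows_eq_fromCols_conjTranspose, Matrix.fromCols_mul_fromRows]
    simp
  · exact (mul_le_mul_of_nonneg_right (by linarith) (vecNorm_nonneg w)).trans
      (mul_vecNorm_le_vecNorm_smul_one_add zero_le_one _ w)
  · refine (Matrix.l2_opNorm_fromRows_zero_left_le _).trans ?_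
    rw [norm_smul, hinv, inv_mul_eq_div, div_le_iff₀ hp]
    have h := le_mul_sub_of_sq_eq hpR hr hp hq hq1
    have h2 : (p + ‖R‖) * q * (1 - ‖R‖ * q / p) * p = (p + ‖R‖) * q * (p - ‖R‖ * q) := by
      field_simp
    linarith

/-- Here the basis is [−X*; pI + R*X*], whose lower block is bounded below by p − ‖R‖q. -/
lemma tan_maxAngle_left_le {R : Matrix ι κ ℂ} {X : Matrix κ ι ℂ} {p q : ℝ} (hp : 0 < p)
    (hpR : p ^ 2 = 1 + ‖R‖ ^ 2) (hX : ‖X‖ ≤ q) (hq1 : q ≤ 1) :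
    let U := colSpan (Matrix.fromRows (0 : Matrix ι κ ℂ) (1 : Matrix κ κ ℂ))
    let V := colSpan ((Matrix.fromBlocks 1 (-R) 0 ((p : ℂ) • 1) :
      Matrix (ι ⊕ κ) (ι ⊕ κ) ℂ)ᴴ * Matrix.fromRows (-Xᴴ) (1 : Matrix κ κ ℂ))
    maxAngle U V < Real.pi / 2 ∧ Real.tan (maxAngle U V) ≤ (p + ‖R‖) * q := by
  intro U V
  have hr := norm_nonneg R
  have hq : 0 ≤ q := (norm_nonneg X).trans hX
  have hpr : ‖R‖ < p := lt_of_pow_lt_pow_left₀ 2 hp.le (by linarith)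
  have hV : V = colSpan (Matrix.fromRows (0 : Matrix ι κ ℂ) (1 : Matrix κ κ ℂ) *
      ((p : ℂ) • (1 : Matrix κ κ ℂ) + Rᴴ * Xᴴ)
      + Matrix.fromRows (-Xᴴ) (0 : Matrix κ κ ℂ)) := by
    simp only [V]
    congr 1
    rw [Matrix.fromBlocks_conjTranspose, Matrix.fromBlocks_mul_fromRows, Matrix.fromRows_mul,
      Matrix.fromRows_add_fromRows]
    simp [add_comm]
  have hRX : ‖Rᴴ * Xᴴ‖ ≤ ‖R‖ * q := by
    refine (Matrix.l2_opNorm_mul _ _).trans ?_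
    rw [Matrix.l2_opNorm_conjTranspose, Matrix.l2_opNorm_conjTranspose]
    gcongr
  have hc : 0 < p - ‖R‖ * q :=
    sub_pos.2 ((mul_le_of_le_one_right hr hq1).trans_lt hpr)
  rw [hV]
  refine tan_maxAngle_colSpan_le (c := p - ‖R‖ * q) ?_ ?_ hc (by positivity) (fun w => ?_) ?_
  · rw [Matrix.conjTranspose_fromRows_eq_fromCols_conjTranspose, Matrix.fromCols_mul_fromRows]
    simp
  · rw [Matrix.conjTranspose_fromRows_eq_fromCols_conjTranspose, Matrix.fromCols_mul_fromRows]
    simp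
  · exact (mul_le_mul_of_nonneg_right (by linarith) (vecNorm_nonneg w)).trans
      (mul_vecNorm_le_vecNorm_smul_one_add hp.le _ w)
  · refine (Matrix.l2_opNorm_fromRows_zero_right_le _).trans ?_
    rw [norm_neg, Matrix.l2_opNorm_conjTranspose]
    exact hX.trans (le_mul_sub_of_sq_eq hpR hr hp hq hq1)

end Perturbation

/-! ### The main theorem. -/

theorem mainTheorem3 {m k : ℕ}
    (A₁₁ : Matrix (Fin m) (Fin m) ℂ) (A₁₂ : Matrix (Fin m) (Fin k) ℂ)
    (A₂₂ : Matrix (Fin k) (Fin k) ℂ) (hs : 0 < sep A₂₂ A₁₁) :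
    let A := Matrix.fromBlocks A₁₁ A₁₂ 0 A₂₂
    let s : ℝ := sep A₂₂ A₁₁
    (∃! R : Matrix (Fin m) (Fin k) ℂ, A₁₁ * R - R * A₂₂ = -A₁₂) ∧
    ∀ R : Matrix (Fin m) (Fin k) ℂ, A₁₁ * R - R * A₂₂ = -A₁₂ →
      let P : Matrix (Fin m ⊕ Fin k) (Fin m ⊕ Fin k) ℂ := Matrix.fromBlocks 1 (-R) 0 0
      let p : ℝ := ‖P‖
      let κ : ℝ := p + √(p ^ 2 - 1)
      let φ : ℝ → ℝ := fun ε => κ * ε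
      let S : Matrix (Fin m ⊕ Fin k) (Fin m ⊕ Fin k) ℂ :=
        Matrix.fromBlocks 1 ((p : ℂ)⁻¹ • R) 0 ((p : ℂ)⁻¹ • 1)
      -- `P` is the spectral projection, and `S` is an optimally conditioned
      -- block-diagonalizing similarity
      IsSpectralProjection A (spectrum ℂ A₁₁) P ∧
      p = √(1 + ‖R‖ ^ 2) ∧
      IsUnit S ∧
      S⁻¹ = Matrix.fromBlocks 1 (-R) 0 ((p : ℂ) • 1) ∧
      S⁻¹ * A * S = Matrix.fromBlocks A₁₁ 0 0 A₂₂ ∧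
      ‖S⁻¹‖ * ‖S‖ = κ ∧
      IsLeast {c : ℝ | ∃ U : Matrix (Fin m ⊕ Fin k) (Fin m ⊕ Fin k) ℂ, IsUnit U ∧
        U⁻¹ * A * U = Matrix.fromBlocks A₁₁ 0 0 A₂₂ ∧ c = ‖U⁻¹‖ * ‖U‖} κ ∧
      -- the perturbation result
      ∀ (E₁₁ : Matrix (Fin m) (Fin m) ℂ) (E₁₂ : Matrix (Fin m) (Fin k) ℂ)
        (E₂₁ : Matrix (Fin k) (Fin m) ℂ) (E₂₂ : Matrix (Fin k) (Fin k) ℂ),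
        let E := Matrix.fromBlocks E₁₁ E₁₂ E₂₁ E₂₂
        ‖E‖ < s / (2 * (p + √(p ^ 2 - 1))) →
        let F₁₁ := E₁₁ - R * E₂₁
        let F₁₂ := (p : ℂ)⁻¹ • (E₁₁ * R + E₁₂ - R * (E₂₁ * R + E₂₂))
        let F₂₂ := E₂₁ * R + E₂₂
        let M : Matrix (Fin k) (Fin m) ℂ → Matrix (Fin m) (Fin m) ℂ :=
          fun X => A₁₁ + F₁₁ + F₁₂ * X
        let N : Matrix (Fin k) (Fin m) ℂ → Matrix (Fin k) (Fin k) ℂ :=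
          fun X => A₂₂ + F₂₂ - X * F₁₂
        let L : Matrix (Fin k) (Fin m) ℂ → Matrix (Fin m ⊕ Fin k) (Fin m ⊕ Fin k) ℂ :=
          fun X => Matrix.fromBlocks 1 0 X 1
        ∃ X : Matrix (Fin k) (Fin m) ℂ,
          ((L X)⁻¹ * S⁻¹ * (A + E) * S * L X = Matrix.fromBlocks (M X) F₁₂ 0 (N X) ∧
            ‖X‖ ≤ 2 * (p + √(p ^ 2 - 1)) * ‖E‖ / s) ∧
          (∀ Y : Matrix (Fin k) (Fin m) ℂ,
            (L Y)⁻¹ * S⁻¹ * (A + E) * S * L Y = Matrix.fromBlocks (M Y) F₁₂ 0 (N Y) →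
            ‖Y‖ ≤ 2 * (p + √(p ^ 2 - 1)) * ‖E‖ / s → Y = X) ∧
          -- (a)
          pseudospectrum (φ ‖E‖) A₁₁ ∩ pseudospectrum (φ ‖E‖) A₂₂ = ∅ ∧
          -- (b)
          spectrum ℂ (M X) ⊆ pseudospectrum (φ ‖E‖) A₁₁ ∧
          spectrum ℂ (N X) ⊆ pseudospectrum (φ ‖E‖) A₂₂ ∧
          -- (c)
          IsRightInvariantPair (A + E) (S * Matrix.fromRows 1 X) (M X) ∧
          IsLeftInvariantPair (A + E) ((S⁻¹)ᴴ * Matrix.fromRows (-Xᴴ) 1) (N X) ∧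
          -- (d)
          (let 𝒳 : Submodule ℂ (EuclideanSpace ℂ (Fin m ⊕ Fin k)) :=
              colSpan (Matrix.fromRows (1 : Matrix (Fin m) (Fin m) ℂ) 0)
            let 𝒳E : Submodule ℂ (EuclideanSpace ℂ (Fin m ⊕ Fin k)) :=
              colSpan (S * Matrix.fromRows 1 X)
            IsInvariantSubspace A 𝒳 ∧ IsInvariantSubspace (A + E) 𝒳E ∧
            maxAngle 𝒳 𝒳E < Real.pi / 2 ∧
            Real.tan (maxAngle 𝒳 𝒳E) ≤ 2 * (p + √(p ^ 2 - 1)) ^ 2 * ‖E‖ / s) ∧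
          -- (e)
          (let 𝒴 : Submodule ℂ (EuclideanSpace ℂ (Fin m ⊕ Fin k)) :=
              colSpan (Matrix.fromRows 0 (1 : Matrix (Fin k) (Fin k) ℂ))
            let 𝒴E : Submodule ℂ (EuclideanSpace ℂ (Fin m ⊕ Fin k)) :=
              colSpan ((S⁻¹)ᴴ * Matrix.fromRows (-Xᴴ) 1)
            IsInvariantSubspace Aᴴ 𝒴 ∧ IsInvariantSubspace (A + E)ᴴ 𝒴E ∧
            maxAngle 𝒴 𝒴E < Real.pi / 2 ∧
            Real.tan (maxAngle 𝒴 𝒴E) ≤ 2 * (p + √(p ^ 2 - 1)) ^ 2 * ‖E‖ / s) := by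
  intro A s
  obtain ⟨⟨_⟩, ⟨_⟩⟩ := nonempty_of_sep_pos hs
  have : Nonempty (Fin m) := ⟨by assumption⟩
  have : Nonempty (Fin k) := ⟨by assumption⟩
  have hinj : ∀ X : Matrix (Fin k) (Fin m) ℂ, A₂₂ * X = X * A₁₁ → X = 0 :=
    fun X => eq_zero_of_sep_pos hs
  refine ⟨existsUnique_sylvester hinj _, fun R hR => ?_⟩
  intro P p κ φ S
  have hpval : p = √(1 + ‖R‖ ^ 2) := Matrix.l2_opNorm_obliqueProjection R
  have hp : 0 < p := hpval ▸ Real.sqrt_pos.2 (by positivity)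
  have hpR : p ^ 2 = 1 + ‖R‖ ^ 2 := by rw [hpval, Real.sq_sqrt (by positivity)]
  have hpC : (p : ℂ) ≠ 0 := Complex.ofReal_ne_zero.2 hp.ne'
  have hκ : κ = p + ‖R‖ := by
    change p + √(p ^ 2 - 1) = p + ‖R‖
    rw [hpR, add_sub_cancel_left, Real.sqrt_sq (norm_nonneg R)]
  have hκpos : 0 < κ := by rw [hκ]; positivity
  have hSinv : S⁻¹ = Matrix.fromBlocks 1 (-R) 0 ((p : ℂ) • 1) := conditionBlock_inv hpC
  have hSu : IsUnit S := conditionBlock_isUnit hpC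
  have hTS : S⁻¹ * S = 1 := Matrix.nonsing_inv_mul S ((Matrix.isUnit_iff_isUnit_det S).1 hSu)
  have hST : S * S⁻¹ = 1 := Matrix.mul_nonsing_inv S ((Matrix.isUnit_iff_isUnit_det S).1 hSu)
  have hdiag : S⁻¹ * A * S = Matrix.fromBlocks A₁₁ 0 0 A₂₂ := by
    rw [hSinv]; exact conditionBlock_conj hR hpC
  have hbound : ∀ U : Matrix (Fin m ⊕ Fin k) (Fin m ⊕ Fin k) ℂ, IsUnit U →
      U⁻¹ * A * U = Matrix.fromBlocks A₁₁ 0 0 A₂₂ → κ ≤ ‖U⁻¹‖ * ‖U‖ := fun U hU hUA => by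
    rw [hκ]
    exact add_norm_le_condition hpR hp hU (mul_eq_obliqueProjection_mul_of_conj hR hinj hU hUA)
  have hcond : ‖S⁻¹‖ * ‖S‖ = κ := by
    refine le_antisymm ?_ (hbound S hSu hdiag)
    rw [hκ, hSinv]
    exact norm_conditionBlock_mul_le hp hpR
  -- This is the case η = 0 of the disjointness of pseudospectra.
  have hspec : Disjoint (spectrum ℂ A₁₁) (spectrum ℂ A₂₂) :=
    (pseudospectrum_disjoint (η := 0) (by simpa using hs)).mono
      (spectrum_subset_pseudospectrum le_rfl _) (spectrum_subset_pseudospectrum le_rfl _)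
  refine ⟨isSpectralProjection_obliqueProjection hR hspec, hpval, hSu, hSinv, hdiag, hcond,
    ⟨⟨S, hSu, hdiag, hcond.symm⟩, ?_⟩, ?_⟩
  · rintro _ ⟨U, hU, hUA, rfl⟩
    exact hbound U hU hUA
  intro E₁₁ E₁₂ E₂₁ E₂₂ E hE F₁₁ F₁₂ F₂₂ M N L
  have hη : 2 * (κ * ‖E‖) < sep A₂₂ A₁₁ := by
    have h := (lt_div_iff₀ (by positivity : 0 < 2 * κ)).1 hE
    linarith
  set q : ℝ := 2 * κ * ‖E‖ / s with hq
  have hq1 : q < 1 := (div_lt_one hs).2 (by linarith)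
  have hqη : 2 * (κ * ‖E‖) / sep A₂₂ A₁₁ = q := by rw [hq, mul_assoc]
  have hconjE : S⁻¹ * E * S = Matrix.fromBlocks F₁₁ F₁₂ ((p : ℂ) • E₂₁) F₂₂ := by
    rw [hSinv]; exact conditionBlock_conj_perturbation R hpC E₁₁ E₁₂ E₂₁ E₂₂
  have hF : ‖Matrix.fromBlocks F₁₁ F₁₂ ((p : ℂ) • E₂₁) F₂₂‖ ≤ κ * ‖E‖ := by
    rw [← hconjE, ← hcond]
    calc ‖S⁻¹ * E * S‖ ≤ ‖S⁻¹‖ * ‖E‖ * ‖S‖ :=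
          (norm_mul_le _ _).trans (by gcongr; exact norm_mul_le _ _)
      _ = _ := by ring
  have hconj : S⁻¹ * (A + E) * S
      = Matrix.fromBlocks (A₁₁ + F₁₁) F₁₂ ((p : ℂ) • E₂₁) (A₂₂ + F₂₂) := by
    rw [mul_add, add_mul, hdiag, hconjE, Matrix.fromBlocks_add]
    simp
  have hiff : ∀ Y, (L Y)⁻¹ * S⁻¹ * (A + E) * S * L Y = Matrix.fromBlocks (M Y) F₁₂ 0 (N Y) ↔
      riccati A₁₁ A₂₂ F₁₁ F₁₂ ((p : ℂ) • E₂₁) F₂₂ Y = 0 := fun Y => by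
    have hassoc : (L Y)⁻¹ * S⁻¹ * (A + E) * S * L Y = (L Y)⁻¹ * (S⁻¹ * (A + E) * S) * L Y := by
      simp only [mul_assoc]
    rw [hassoc, hconj, show (L Y)⁻¹ = _ from Matrix.inv_fromBlocks_one_zero_one Y]
    exact blockLower_conj_eq_iff_riccati
  obtain ⟨X, hX, hXq⟩ := riccati_exists hη hF
  rw [hqη] at hXq
  have hX1 : ‖X‖ ≤ 1 := hXq.trans hq1.le
  have hsep := two_mul_lt_of_mem_pseudospectrum hη
  have hright : IsRightInvariantPair (A + E)
      (S * Matrix.fromRows (1 : Matrix (Fin m) (Fin m) ℂ) X) (M X) :=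
    isRightInvariantPair_of_conj hST hTS hconj (blocks_mul_fromRows_of_riccati hX)
  have hleft : IsLeftInvariantPair (A + E)
      ((S⁻¹)ᴴ * Matrix.fromRows (-Xᴴ) (1 : Matrix (Fin k) (Fin k) ℂ)) (N X) :=
    isLeftInvariantPair_of_conj hST hTS hconj (fromCols_mul_blocks_of_riccati hX)
  have hτ : (p + ‖R‖) * q = 2 * κ ^ 2 * ‖E‖ / s := by rw [← hκ, hq]; ring
  refine ⟨X, ⟨(hiff X).2 hX, hXq⟩, fun Y hY hYq => ?_, ?_, ?_, ?_, hright, hleft, ?_, ?_⟩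
  · exact riccati_unique hη hF ((hiff Y).1 hY) (hYq.trans hq1.le) hX hX1
  · exact Set.disjoint_iff_inter_eq_empty.1 (pseudospectrum_disjoint hη)
  · exact spectrum_subset_pseudospectrum_of_riccati hsep hF hX hX1
  · exact spectrum_subset_pseudospectrum_of_riccati_left
      (fun a b z ha hb => (hsep b a z hb ha).trans_eq (add_comm b a)) hF hX hX1
  · refine ⟨isInvariantSubspace_colSpan (M := A₁₁) ?_, isInvariantSubspace_colSpan hright.2, ?_⟩
    · rw [Matrix.fromBlocks_mul_fromRows, Matrix.fromRows_mul]
      simp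
    · have h := tan_maxAngle_right_le hp hpR hXq hq1.le
      exact ⟨h.1, h.2.trans_eq hτ⟩
  · refine ⟨isInvariantSubspace_colSpan (M := A₂₂ᴴ) ?_,
      isInvariantSubspace_colSpan hleft.conjTranspose_mul_eq, ?_⟩
    · rw [Matrix.fromBlocks_conjTranspose, Matrix.fromBlocks_mul_fromRows, Matrix.fromRows_mul]
      simp
    · have h := tan_maxAngle_left_le hp hpR hXq hq1.le
      rw [hSinv]
      exact ⟨h.1, h.2.trans_eq hτ⟩
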